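/- For $n\ge 1$ let $B_n$ be the braid group on $n$ strands with standard generators $\sigma_1,\dots,\sigma_{n-1}$, and for $w\in B_n$ let $w^*$ be its mirror image, the braid obtained from $w$ by reversing all crossings (the image of $w$ under the automorphism $\sigma_i\mapsto\sigma_i^{-1}$). For a knot $K$ with Alexander polynomial $\Delta_K(t)$, the Conway polynomial $C_K(z)\in\mathbb Z[z]$ is the unique integer polynomial with $C_K(0)=1$ and $C_K(\sqrt t-1/\sqrt t)=\Delta_K(t)$ up to a unit $\pm t^{j/2}$, $j\in\mathbb Z$. **Corollary.** Let $n$ be odd, let $w\in B_n$ and let $k\ge 1$. If the standard closure of the braid $(ww^*)^k$ is a knot $K$, then its Conway polynomial splits modulo $4$: $$C_K(z)\equiv f(z)\,f(-z)\pmod 4\qquad\text{for some } f\in\mathbb Z_4[z],$$ where $\mathbb Z_4=\mathbb Z/4\mathbb Z$. -/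

import Mathlib

open Polynomial LaurentPolynomial

/-! ### Braids -/

/-- Artin's relations on the generators `σ₁, …, σₙ₋₁` (indexed from `0`):
`σᵢ σⱼ = σⱼ σᵢ` for `|i - j| ≥ 2` and `σᵢ σᵢ₊₁ σᵢ = σᵢ₊₁ σᵢ σᵢ₊₁`. -/
def braidRelations (n : ℕ) : Set (FreeGroup (Fin (n - 1))) :=
  {r | ∃ i j : Fin (n - 1), i.val + 2 ≤ j.val ∧
    r = (FreeGroup.of i * FreeGroup.of j) * (FreeGroup.of j * FreeGroup.of i)⁻¹} ∪
  {r | ∃ i j : Fin (n - 1), i.val + 1 = j.val ∧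
    r = (FreeGroup.of i * FreeGroup.of j * FreeGroup.of i) *
      (FreeGroup.of j * FreeGroup.of i * FreeGroup.of j)⁻¹}

/-- The braid group `Bₙ` on `n` strands. -/
abbrev BraidGroup (n : ℕ) : Type := PresentedGroup (braidRelations n)

namespace BraidGroup

/-- The standard generator `σᵢ`. -/
def σ {n : ℕ} (i : Fin (n - 1)) : BraidGroup n := PresentedGroup.of i

theorem σ_comm {n : ℕ} (i j : Fin (n - 1)) (h : i.val + 2 ≤ j.val) :
    (σ i * σ j : BraidGroup n) = σ j * σ i := by
  have h1 := PresentedGroup.one_of_mem (rels := braidRelations n) (Or.inl ⟨i, j, h, rfl⟩)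
  rw [map_mul, map_inv, mul_inv_eq_one, map_mul, map_mul] at h1
  exact h1

theorem σ_braid {n : ℕ} (i j : Fin (n - 1)) (h : i.val + 1 = j.val) :
    (σ i * σ j * σ i : BraidGroup n) = σ j * σ i * σ j := by
  have h1 := PresentedGroup.one_of_mem (rels := braidRelations n) (Or.inr ⟨i, j, h, rfl⟩)
  rw [map_mul, map_inv, mul_inv_eq_one, map_mul, map_mul, map_mul, map_mul] at h1
  exact h1

/-- The mirror image `w ↦ w*`, which reverses all the crossings of a braid: the automorphism
of `Bₙ` with `σᵢ ↦ σᵢ⁻¹`. -/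
def mirror {n : ℕ} : BraidGroup n →* BraidGroup n :=
  PresentedGroup.toGroup (f := fun i => (σ i : BraidGroup n)⁻¹) (by
    rintro r (⟨i, j, h, rfl⟩ | ⟨i, j, h, rfl⟩)
    · simp only [map_mul, map_inv, FreeGroup.lift_apply_of, mul_inv_eq_one]
      rw [← mul_inv_rev, ← mul_inv_rev, σ_comm i j h]
    · simp only [map_mul, map_inv, FreeGroup.lift_apply_of, mul_inv_eq_one]
      have h1 := congrArg (fun x => x⁻¹) (σ_braid (n := n) i j h)
      simpa only [mul_inv_rev, mul_assoc] using h1)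

end BraidGroup

/-- A braid word on `n` strands: the letter `(i, true)` stands for `σᵢ` and the letter
`(i, false)` for `σᵢ⁻¹`. -/
abbrev BraidWord (n : ℕ) : Type := List (Fin (n - 1) × Bool)

/-- The braid represented by a braid word. -/
def BraidWord.toBraid {n : ℕ} (v : BraidWord n) : BraidGroup n :=
  PresentedGroup.mk (braidRelations n) (FreeGroup.mk v)

/-! ### Oriented link diagrams -/

/-- An oriented link diagram, recorded by its signed Gauss code. The link is cut into finitely many
oriented edges; `next e` is the edge that follows `e`, so that the components of the link are the
cycles of `next`. At a crossing `c` the edge `upper c` arrives on the upper strand and the edge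
`lower c` on the lower strand, and they continue as `next (upper c)` and `next (lower c)`.
An edge that does not arrive at a crossing is joined to the following one at a plain point. -/
structure LinkDiagram where
  Edge : Type
  Crossing : Type
  [fintypeEdge : Fintype Edge]
  [decEqEdge : DecidableEq Edge]
  [fintypeCrossing : Fintype Crossing]
  next : Equiv.Perm Edge
  upper : Crossing → Edge
  lower : Crossing → Edge
  /-- the sign `±1` of the crossing -/
  sign : Crossing → ℤˣ
  injective : Function.Injective (Sum.elim upper lower)

namespace LinkDiagram

attribute [instance] fintypeEdge decEqEdge fintypeCrossing

/-- The diagram shows a knot: there is exactly one component. -/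
def IsKnot (D : LinkDiagram) : Prop :=
  Nonempty D.Edge ∧ ∀ e e' : D.Edge, D.next.SameCycle e e'

/-- The Alexander matrix: the Fox Jacobian, with every generator sent to `t`, of the Wirtinger
presentation of the link group. There is one generator `x_e` for every edge `e`. If `e` arrives at
a crossing `c` of sign `ε` on the lower strand, the relation is `x_{next e} = x_o^ε x_e x_o^{-ε}`
with `o = upper c`, and its row is `[next e] - t^ε [e] - (1 - t^ε) [o]`; for every other edge the
relation is `x_{next e} = x_e`, with row `[next e] - [e]`. -/
noncomputable def alexanderMatrix (D : LinkDiagram) : Matrix D.Edge D.Edge ℤ[T;T⁻¹] :=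
  Matrix.of fun e =>
    Pi.single (D.next e) 1 - Pi.single e 1 +
      ∑ c with D.lower c = e,
        (1 - T (D.sign c : ℤ) : ℤ[T;T⁻¹]) • (Pi.single e 1 - Pi.single (D.upper c) 1)

/-- `Δ` is an Alexander polynomial of the diagram: a greatest common divisor of the minors of
size `N - 1` of the `N × N` Alexander matrix, which are, up to sign, the entries of its adjugate.
It is determined up to multiplication by a unit `± t ^ k`. -/
def IsAlexanderPolynomial (D : LinkDiagram) (Δ : ℤ[T;T⁻¹]) : Prop :=
  ∀ d : ℤ[T;T⁻¹], d ∣ Δ ↔ ∀ e e' : D.Edge, d ∣ D.alexanderMatrix.adjugate e e'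

/-- The substitution `t ↦ s ^ 2` on Laurent polynomials, so that `s` is `√t`. -/
noncomputable def substSq : ℤ[T;T⁻¹] →+* ℤ[T;T⁻¹] :=
  AddMonoidAlgebra.mapDomainRingHom ℤ (AddMonoidHom.mulLeft (2 : ℤ))

/-- `C` is the Conway polynomial of the knot shown by the diagram: it is obtained from the
Alexander polynomial `Δ` by the change of variables `z = √t - 1/√t`, that is,
`C (s - s⁻¹) = Δ (s ^ 2)` up to a unit, with `Δ` normalized to `C 0 = Δ 1 = 1`. -/
def IsConwayPolynomial (D : LinkDiagram) (C : ℤ[X]) : Prop :=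
  C.eval 0 = 1 ∧ ∃ Δ : ℤ[T;T⁻¹], D.IsAlexanderPolynomial Δ ∧
    Associated (aeval (T 1 - T (-1) : ℤ[T;T⁻¹]) C) (substSq Δ)

end LinkDiagram

/-! ### Closed braids -/

namespace BraidWord

/-- The left one of the two positions that `σᵢ` interchanges. -/
def left {n : ℕ} (i : Fin (n - 1)) : Fin n := ⟨i.val, by omega⟩

/-- The right one of the two positions that `σᵢ` interchanges. -/
def right {n : ℕ} (i : Fin (n - 1)) : Fin n := ⟨i.val + 1, by omega⟩

theorem left_ne_right {n : ℕ} (i : Fin (n - 1)) : left i ≠ right i := by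
  simp [left, right]

/-- How the positions of the strands change from level `j` to the next level. The letter number `j`
lies there if `j` is less than the length of the word; from the last level the strands return
straight to level `0`. -/
def stepPerm {n : ℕ} (v : BraidWord n) (j : Fin (v.length + 1)) : Equiv.Perm (Fin n) :=
  if h : j.val < v.length then Equiv.swap (left v[j.val].1) (right v[j.val].1) else 1

/-- The diagram of the standard closure of a braid word. The edge `(j, p)` is the piece of strand
at position `p` on level `j`, before the letter number `j`. In `σᵢ` the strand from the left passes
over and the crossing is positive; in `σᵢ⁻¹` the strand from the right passes over and the crossing
is negative. -/
def closure {n : ℕ} (v : BraidWord n) : LinkDiagram where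
  Edge := Fin (v.length + 1) × Fin n
  Crossing := Fin v.length
  next := Equiv.prodShear (finRotate (v.length + 1)) v.stepPerm
  upper j := (j.castSucc, if v[j].2 then left v[j].1 else right v[j].1)
  lower j := (j.castSucc, if v[j].2 then right v[j].1 else left v[j].1)
  sign j := if v[j].2 then 1 else -1
  injective := by
    have key : ∀ (i : Fin (n - 1)) (b : Bool),
        (if b then left i else right i) ≠ (if b then right i else left i) := by
      intro i b
      cases b
      · simpa using (left_ne_right i).symm
      · simpa using left_ne_right i
    rintro (j | j) (l | l) h <;>
      simp only [Sum.elim_inl, Sum.elim_inr, Prod.mk.injEq, Fin.castSucc_inj] at h <;>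
      obtain ⟨rfl, h⟩ := h
    · rfl
    · exact absurd h (key _ _)
    · exact absurd h.symm (key _ _)
    · rfl

end BraidWord

/-! Write n = 2m+1, t = s², y = s + 1/s, z = s − 1/s, let [n] be `quantumInt n` and ψ the reduced
Burau representation in Squier's coordinates. For the closure of g, the Alexander polynomial Δ,
suitably normalized, satisfies Δ(s²)·[n] = det(1 − ψ(g)) (`exists_isAlexanderPolynomial`). There is
a symmetric matrix J of determinant [n] with ψ(g)ᵀ J ψ(g*) = J, and ψ(g*) is ψ(g) with s replaced by
1/s (`burau_form`, `burau_mirror`, `det_form`).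

If k = 2^a(2j+1) and W = (ww*)^j w, then (ww*)^k = (WW*)^(2^a), so only exponents that are powers of
2 matter. Induct on a, with M = ψ((WW*)^(2^a)). For a = 0, multiplying 1 − ψ(W)ψ(W*) by J⁻¹ψ(W)ᵀ
gives a skew-symmetric matrix, so its determinant is a square. Since det ψ(W) is a square up to sign
and det J = [n], Δ(s²) is a square up to sign (`exists_sq_eq`). It is also an even polynomial in y,
hence ±F(y)F(−y). For the induction step, det(1 − M²) = det(1 − M)·det(1 + M). The characteristic
polynomial of M is reciprocal, x^m q(x + 1/x) (`charpoly_burau_palindromic`). If M is itself the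
square of such a matrix, with q now belonging to that matrix, then det(1 + M) = q(0)² is a square
and splits as before. If a = 0, the values q(2) and q(−2) agree modulo 4, so det(1 + M) ≡ ±det(1 −
M) = ±Δ(s²)[n]; the new polynomial is ±Δ(s²)²[n] modulo 4, and [n] = ±P(y)P(−y)
(`exists_quantumInt_eq`).

Finally Δ(t) = H(t + 1/t) with t + 1/t = y² − 2 = z² + 2. Thus C(z) = ±H(z² + 2), which modulo 4 is
the polynomial ±H(z² − 2) already split in the variable y. The sign is right because −1 is not a
square modulo 4. -/

/-! ### Linear algebra: skew-symmetric determinants, adjugates, cyclic block matrices -/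

namespace Matrix

/-- The determinant of a skew-symmetric matrix is a square. -/
theorem isSquare_det_of_transpose_eq_neg {K ι : Type*} [Field K] [Fintype ι] [DecidableEq ι]
    (h2 : (2 : K) ≠ 0) (M : Matrix ι ι K) (hM : Mᵀ = -M) : IsSquare M.det := by
  induction h : Fintype.card ι using Nat.strong_induction_on generalizing ι with
  | _ k ih =>
  have hd : ∀ i j, M j i = -M i j := fun i j => congrFun (congrFun hM i) j
  by_cases h0 : M = 0
  · subst h0
    rcases isEmpty_or_nonempty ι with hι | hι
    · simp
    · rw [det_zero]; exact IsSquare.zero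
  obtain ⟨i, j, hij⟩ : ∃ i j, M i j ≠ 0 := by
    by_contra! hc
    exact h0 (by ext i j; exact hc i j)
  have hdiag : ∀ i, M i i = 0 := by
    intro i
    have h1 := hd i i
    have h3 : 2 * M i i = 0 := by linear_combination h1
    exact (mul_eq_zero.mp h3).resolve_left h2
  have hne : i ≠ j := by
    rintro rfl
    exact hij (hdiag i)
  let p : ι → Prop := fun a => a = i ∨ a = j
  let e : {a // p a} ⊕ {a // ¬ p a} ≃ ι := Equiv.sumCompl p
  have hcard : Fintype.card {a // p a} = 2 := by
    rw [Fintype.card_subtype]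
    have : (Finset.univ.filter p) = {i, j} := by ext a; simp [p]
    rw [this, Finset.card_pair hne]
  have hcard' : Fintype.card {a // ¬ p a} < k := by
    rw [Fintype.card_subtype_compl, hcard, h]
    have : 0 < Fintype.card ι := Fintype.card_pos_iff.mpr ⟨i⟩
    omega
  let f := Fintype.equivFinOfCardEq hcard
  let A : Matrix {a // p a} {a // p a} K := M.submatrix (↑) (↑)
  let B : Matrix {a // p a} {a // ¬ p a} K := M.submatrix (↑) (↑)
  let C : Matrix {a // ¬ p a} {a // p a} K := M.submatrix (↑) (↑)
  let D : Matrix {a // ¬ p a} {a // ¬ p a} K := M.submatrix (↑) (↑)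
  have hblocks : M.submatrix e e = fromBlocks A B C D := by
    ext (a | a) (b | b) <;> rfl
  have hAT : Aᵀ = -A := by ext a b; exact hd _ _
  have hBT : Bᵀ = -C := by ext a b; exact hd _ _
  have hCT : Cᵀ = -B := by ext a b; exact hd _ _
  have hDT : Dᵀ = -D := by ext a b; exact hd _ _
  have hdetA : A.det = A (f.symm 0) (f.symm 1) ^ 2 := by
    rw [← det_submatrix_equiv_self f.symm A, det_fin_two]
    simp only [submatrix_apply, A]
    rw [hdiag, hd (f.symm 0 : ι) (f.symm 1 : ι)]
    ring
  have hA0 : A (f.symm 0) (f.symm 1) ≠ 0 := by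
    have hne' : ((f.symm 0 : {a // p a}) : ι) ≠ (f.symm 1 : {a // p a}) := by
      rw [Ne, Subtype.coe_inj, f.symm.injective.eq_iff]; simp
    change M _ _ ≠ 0
    rcases (f.symm 0).2 with h0 | h0 <;> rcases (f.symm 1).2 with h1 | h1 <;> rw [h0, h1]
    · exact absurd (h0.trans h1.symm) hne'
    · exact hij
    · rw [hd]; exact neg_ne_zero.mpr hij
    · exact absurd (h0.trans h1.symm) hne'
  have hAu : IsUnit A.det := by rw [hdetA]; exact (pow_ne_zero 2 hA0).isUnit
  let := A.invertibleOfIsUnitDet hAu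
  -- The 2 × 2 pivot block has square determinant, and its Schur complement is again skew-symmetric,
  -- of smaller size.
  rw [← det_submatrix_equiv_self e M, hblocks, det_fromBlocks₁₁]
  refine IsSquare.mul ?_ (ih _ hcard' _ ?_ rfl)
  · rw [hdetA]; exact IsSquare.sq _
  · rw [invOf_eq_nonsing_inv, transpose_sub, transpose_mul, transpose_mul, transpose_nonsing_inv,
      hAT, hBT, hCT, hDT]
    have : (-A)⁻¹ = -A⁻¹ := by
      apply inv_eq_left_inv
      rw [neg_mul_neg, nonsing_inv_mul _ hAu]
    rw [this]
    simp only [Matrix.neg_mul, Matrix.mul_neg, neg_neg, neg_sub, Matrix.mul_assoc]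
    abel

section Adjugate

variable {R ι : Type*} [CommRing R] [Fintype ι] [DecidableEq ι]

theorem det_add_vecMulVec_single (A : Matrix ι ι R) (a : ι → R) (i : ι) :
    (A + vecMulVec a (Pi.single i 1)).det = A.det + ∑ j, A.adjugate i j * a j := by
  have h1 : A + vecMulVec a (Pi.single i 1) = A.updateCol i ((fun k => A k i) + a) := by
    ext k l
    by_cases h : l = i
    · subst h; simp [vecMulVec_apply]
    · simp [vecMulVec_apply, h]
  rw [h1, det_updateCol_add, show A.updateCol i (fun k => A k i) = A from updateCol_eq_self A i,
    ← cramer_apply, cramer_eq_adjugate_mulVec]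
  rfl

/-- Replacing column i by u_k e_j − u_j e_k keeps u in the left kernel, so the new determinant
vanishes; expanding it along that column gives the identity. -/
theorem adjugate_mul_of_vecMul_eq_zero [IsDomain R] {A : Matrix ι ι R} {u : ι → R}
    (h : u ᵥ* A = 0) (i j k : ι) : A.adjugate i j * u k = A.adjugate i k * u j := by
  by_cases hu : u = 0
  · simp [hu]
  have h1 : (A.updateCol i (u k • Pi.single j 1 - u j • Pi.single k 1)).det = 0 := by
    refine exists_vecMul_eq_zero_iff.mp ⟨u, hu, ?_⟩
    ext l
    by_cases hl : l = i
    · subst hl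
      simp [vecMul, dotProduct, mul_sub, Finset.sum_sub_distrib, Pi.single_apply, mul_comm]
    · have := congrFun h l
      simp only [vecMul, dotProduct, Pi.zero_apply] at this ⊢
      simpa [hl] using this
  rw [← cramer_apply, map_sub, map_smul, map_smul, cramer_eq_adjugate_mulVec,
    cramer_eq_adjugate_mulVec, mulVec_single_one, mulVec_single_one] at h1
  simp only [Pi.sub_apply, Pi.smul_apply, col_apply, smul_eq_mul] at h1
  linear_combination h1

theorem adjugate_eq_of_mulVec_one_eq_zero [IsDomain R] {A : Matrix ι ι R}
    (h : A *ᵥ 1 = 0) (i j k : ι) : A.adjugate i k = A.adjugate j k := by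
  have h1 : (1 : ι → R) ᵥ* Aᵀ = 0 := by rw [vecMul_transpose, h]
  have h2 := adjugate_mul_of_vecMul_eq_zero h1 k i j
  rw [← adjugate_transpose] at h2
  simpa using h2

end Adjugate

/-- The cyclic block matrix of the system `x (j + 1) = B j * x j` around a circle
of `L + 1` levels. -/
def cyclicBlock {R : Type*} [CommRing R] {n : ℕ} (L : ℕ) (B : ℕ → Matrix (Fin n) (Fin n) R) :
    Matrix (Fin (L + 1) × Fin n) (Fin (L + 1) × Fin n) R :=
  of fun a b => (if a = b then 1 else 0) - if a.1 = b.1 + 1 then B b.1 a.2 b.2 else 0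

/-- The product `B (j - 1) * ⋯ * B 0`. -/
def revProd {R : Type*} [CommRing R] {n : ℕ} (B : ℕ → Matrix (Fin n) (Fin n) R) :
    ℕ → Matrix (Fin n) (Fin n) R
  | 0 => 1
  | j + 1 => B j * revProd B j

theorem det_eq_one_of_unitriangular {R ι α : Type*} [CommRing R] [Fintype ι] [DecidableEq ι]
    [LinearOrder α] {M : Matrix ι ι R} (f : ι → α)
    (h : ∀ a b, f a ≤ f b → M a b = if a = b then 1 else 0) : M.det = 1 := by
  have h1 : M.BlockTriangular (fun a => OrderDual.toDual (f a)) := by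
    intro a b hab
    have hab : f a < f b := hab
    rw [h a b hab.le, if_neg (by rintro rfl; exact hab.ne rfl)]
  rw [h1.det]
  refine Finset.prod_eq_one fun k _ => ?_
  have h2 : M.toSquareBlock (fun a => OrderDual.toDual (f a)) k = 1 := by
    ext ⟨a, ha⟩ ⟨b, hb⟩
    rw [toSquareBlock_def, of_apply, h a b (OrderDual.toDual.injective (ha.trans hb.symm)).le,
      one_apply]
    simp
  rw [h2, det_one]

/-- Propagating a vector from level 0 around the circle solves every block equation but the one that
closes up. These solutions form the first block column of a unitriangular `U`; multiplying by it
leaves a block triangular matrix. -/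
theorem det_cyclicBlock_add {R : Type*} [CommRing R] {n : ℕ} (L : ℕ)
    (B : ℕ → Matrix (Fin n) (Fin n) R) (D : Matrix (Fin n) (Fin n) R) :
    (cyclicBlock L B + of fun a b : Fin (L + 1) × Fin n =>
      if a.1 = 0 ∧ b.1 = 0 then D a.2 b.2 else 0).det = (1 - revProd B (L + 1) + D).det := by
  set M := cyclicBlock L B + of fun a b : Fin (L + 1) × Fin n =>
    if a.1 = 0 ∧ b.1 = 0 then D a.2 b.2 else 0 with hM
  let U : Matrix (Fin (L + 1) × Fin n) (Fin (L + 1) × Fin n) R :=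
    of fun a b => if b.1 = 0 then revProd B a.1 a.2 b.2 else if a = b then 1 else 0
  have hU : U.det = 1 := by
    refine det_eq_one_of_unitriangular Prod.fst ?_
    rintro ⟨a, p⟩ ⟨b, q⟩ h
    have h : a ≤ b := h
    by_cases hb : b = 0
    · subst hb
      obtain rfl : a = 0 := le_antisymm h (Fin.zero_le a)
      simp [U, revProd, one_apply]
    · simp [U, hb]
  have hcol : ∀ a b : Fin (L + 1) × Fin n, b.1 ≠ 0 → (M * U) a b = M a b := by
    intro a b hb
    simp [mul_apply, U, hb]
  have hzero : ∀ a q, (M * U) a (0, q) = revProd B a.1 a.2 q -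
      (B (a.1 - 1 : Fin (L + 1)) * revProd B (a.1 - 1 : Fin (L + 1))) a.2 q +
      if a.1 = 0 then D a.2 q else 0 := by
    rintro ⟨a, p⟩ q
    have h1 : ∀ c : Fin (L + 1), a = c + 1 ↔ c = a - 1 := fun c => by
      rw [eq_sub_iff_add_eq, eq_comm]
    simp only [mul_apply, hM, U, cyclicBlock, add_apply, of_apply, add_mul, sub_mul,
      Finset.sum_add_distrib, Finset.sum_sub_distrib, Fintype.sum_prod_type, if_true]
    congr 1
    · congr 1
      · simp [Prod.ext_iff, ite_and]
      · simp [h1]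
    · by_cases ha : a = 0
      · simp [ha, revProd, one_apply]
      · simp [ha]
  have hp : ∀ a : Fin (L + 1) × Fin n, ¬ a.1 = 0 → ∀ b : Fin (L + 1) × Fin n, b.1 = 0 →
      (M * U) a b = 0 := by
    rintro ⟨a, p⟩ ha ⟨b, q⟩ hb
    obtain rfl : b = 0 := hb
    have ha : a ≠ 0 := ha
    obtain ⟨j, rfl⟩ := Fin.exists_succ_eq.mpr ha
    rw [hzero]
    have h1 : ((j.succ - 1 : Fin (L + 1)) : ℕ) = j := by
      rw [← Fin.coeSucc_eq_succ, add_sub_cancel_right]; simp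
    simp [h1, revProd]
  have h1 : M.det = (M * U).det := by rw [det_mul, hU, mul_one]
  rw [h1, twoBlockTriangular_det (M * U) (fun a => a.1 = 0) hp]
  have h2 : (toSquareBlockProp (M * U) fun a => ¬ a.1 = 0).det = 1 := by
    refine det_eq_one_of_unitriangular (fun a => a.1.1) ?_
    rintro ⟨⟨a, p⟩, ha⟩ ⟨⟨b, q⟩, hb⟩ h
    have h : a ≤ b := h
    have ha : a ≠ 0 := ha
    have hb : b ≠ 0 := hb
    rw [toSquareBlockProp_def, of_apply, hcol _ _ hb]
    -- Addition in `Fin (L + 1)` wraps around, so `a = b + 1` with `a ≤ b` would force a = 0.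
    have h3 : ¬ a = b + 1 := by
      intro hc
      rcases eq_or_ne b (Fin.last L) with rfl | hl
      · rw [Fin.last_add_one] at hc
        exact ha hc
      · have := Fin.lt_add_one_iff.mpr (lt_of_le_of_ne (Fin.le_last b) hl)
        rw [← hc] at this
        exact absurd h (not_le.mpr this)
    simp [hM, cyclicBlock, ha, h3]
  rw [h2, mul_one]
  let e : Fin n ≃ {a : Fin (L + 1) × Fin n // a.1 = 0} :=
    { toFun := fun q => ⟨(0, q), rfl⟩
      invFun := fun a => a.1.2
      left_inv := fun q => rfl
      right_inv := by
        rintro ⟨⟨a, q⟩, h⟩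
        obtain rfl : a = 0 := h
        rfl }
  rw [← det_submatrix_equiv_self e]
  congr 1
  ext p q
  have h4 : ((-1 : Fin (L + 1)) : ℕ) = L := by
    rw [← eq_neg_of_add_eq_zero_left (Fin.last_add_one L), Fin.val_last]
  simp only [submatrix_apply, toSquareBlockProp_def, of_apply, e, Equiv.coe_fn_mk, hzero,
    zero_sub, h4, if_true, Fin.val_zero]
  simp [revProd]

end Matrix

/-! ### The reduced Burau representation and its invariant form -/

namespace BraidGroup

open Matrix

/-- The symmetric bilinear form preserved by the Burau representation. -/
noncomputable def form (k : ℕ) : Matrix (Fin k) (Fin k) ℤ[T;T⁻¹] :=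
  of fun i j => if i = j then T 1 + T (-1)
    else if i.val + 1 = j.val ∨ j.val + 1 = i.val then -1 else 0

theorem form_self {k : ℕ} (i : Fin k) : form k i i = T 1 + T (-1) := by simp [form]

theorem form_adj {k : ℕ} {i j : Fin k} (h : i.val + 1 = j.val) : form k i j = -1 := by
  have : i ≠ j := by rintro rfl; omega
  simp [form, h, this]

theorem form_adj' {k : ℕ} {i j : Fin k} (h : i.val + 1 = j.val) : form k j i = -1 := by
  have : j ≠ i := by rintro rfl; omega
  simp [form, h, this]

theorem form_far {k : ℕ} {i j : Fin k} (h : i.val + 2 ≤ j.val) : form k i j = 0 := by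
  have : i ≠ j := by rintro rfl; omega
  simp only [form, of_apply, this, if_false]
  rw [if_neg (by omega)]

theorem form_far' {k : ℕ} {i j : Fin k} (h : i.val + 2 ≤ j.val) : form k j i = 0 := by
  have : j ≠ i := by rintro rfl; omega
  simp only [form, of_apply, this, if_false]
  rw [if_neg (by omega)]

theorem form_transpose (k : ℕ) : (form k)ᵀ = form k := by
  ext1 i j
  simp only [form, transpose_apply, of_apply, eq_comm (a := j), or_comm]

theorem form_map_invert (k : ℕ) : (form k).map invert = form k := by
  ext1 i j
  simp only [form, map_apply, of_apply]
  split_ifs <;> simp [add_comm]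

/-- The images of the Temperley-Lieb generators. -/
noncomputable def tl {k : ℕ} (i : Fin k) : Matrix (Fin k) (Fin k) ℤ[T;T⁻¹] :=
  single i i 1 * form k

theorem tl_mul_tl {k : ℕ} (i j : Fin k) :
    tl i * tl j = form k i j • (single i j 1 * form k) := by
  rw [tl, tl, Matrix.mul_assoc, ← Matrix.mul_assoc (form k), ← Matrix.mul_assoc,
    ← Matrix.mul_assoc, single_mul_mul_single, ← smul_mul_assoc, smul_single]
  simp

theorem tl_mul_self {k : ℕ} (i : Fin k) : tl i * tl i = (T 1 + T (-1) : ℤ[T;T⁻¹]) • tl i := by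
  rw [tl_mul_tl, form_self, tl]

theorem tl_mul_mul {k : ℕ} (i j : Fin k) :
    tl i * tl j * tl i = (form k i j * form k j i) • tl i := by
  rw [tl_mul_tl, smul_mul_assoc, tl, Matrix.mul_assoc, ← Matrix.mul_assoc (form k),
    ← Matrix.mul_assoc, ← Matrix.mul_assoc, single_mul_mul_single, mul_smul,
    ← smul_mul_assoc (form k j i), smul_single]
  simp

/-- With e² = (s + 1/s)e, the cross terms cancel because s^a + s^b is exactly s + 1/s; this is why
one exponent must be 1. -/
theorem one_sub_tl_mul {k : ℕ} (i : Fin k) {a b : ℤ} (h : a + b = 0) (h1 : a = 1 ∨ b = 1) :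
    (1 - (T a : ℤ[T;T⁻¹]) • tl i) * (1 - (T b : ℤ[T;T⁻¹]) • tl i) = 1 := by
  have h2 : (T a * T b : ℤ[T;T⁻¹]) = 1 := by rw [← T_add, h, T_zero]
  have h3 : (T 1 + T (-1) : ℤ[T;T⁻¹]) = T a + T b := by
    rcases h1 with rfl | rfl
    · obtain rfl : b = -1 := by omega
      rfl
    · obtain rfl : a = -1 := by omega
      rw [add_comm]
  have h4 : (T a : ℤ[T;T⁻¹]) • tl i * (T b : ℤ[T;T⁻¹]) • tl i =
      (T a + T b : ℤ[T;T⁻¹]) • tl i := by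
    rw [smul_mul_smul_comm, h2, one_smul, tl_mul_self, h3]
  rw [sub_mul, mul_sub, mul_sub, h4, add_smul]
  simp

/-- The image of a generator under the Burau representation. -/
noncomputable def burauGen {k : ℕ} (i : Fin k) : (Matrix (Fin k) (Fin k) ℤ[T;T⁻¹])ˣ where
  val := 1 - (T 1 : ℤ[T;T⁻¹]) • tl i
  inv := 1 - (T (-1) : ℤ[T;T⁻¹]) • tl i
  val_inv := one_sub_tl_mul i (by norm_num) (by norm_num)
  inv_val := one_sub_tl_mul i (by norm_num) (by norm_num)

theorem burauGen_comm {k : ℕ} {i j : Fin k} (h : i.val + 2 ≤ j.val) :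
    burauGen i * burauGen j = burauGen j * burauGen i := by
  ext1
  have h1 : tl i * tl j = 0 := by rw [tl_mul_tl, form_far h, zero_smul]
  have h2 : tl j * tl i = 0 := by rw [tl_mul_tl, form_far' h, zero_smul]
  simp only [burauGen, Units.val_mul, sub_mul, mul_sub, smul_mul_smul_comm, h1, h2, one_mul,
    mul_one, smul_zero]
  abel

theorem burauGen_braid {k : ℕ} {i j : Fin k} (h : i.val + 1 = j.val) :
    burauGen i * burauGen j * burauGen i = burauGen j * burauGen i * burauGen j := by
  ext1
  -- The Temperley–Lieb relations x² = (s + 1/s)x and xyx = x turn the triple product into an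
  -- expression symmetric in x and y, which is the braid relation.
  have key : ∀ x y : Matrix (Fin k) (Fin k) ℤ[T;T⁻¹],
      x * x = (T 1 + T (-1) : ℤ[T;T⁻¹]) • x → x * y * x = x →
      (1 - (T 1 : ℤ[T;T⁻¹]) • x) * (1 - (T 1 : ℤ[T;T⁻¹]) • y) * (1 - (T 1 : ℤ[T;T⁻¹]) • x) =
        1 - (T 1 : ℤ[T;T⁻¹]) • (x + y) + (T 2 : ℤ[T;T⁻¹]) • (x * y + y * x) := by
    intro x y h1 h2
    have h3 : (T 1 * T (-1) : ℤ[T;T⁻¹]) = 1 := by rw [← T_add]; simp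
    have h4 : (T 2 : ℤ[T;T⁻¹]) = T 1 * T 1 := by rw [← T_add]; rfl
    rw [h4]
    generalize (T 1 : ℤ[T;T⁻¹]) = a at *
    generalize (T (-1) : ℤ[T;T⁻¹]) = b at *
    have h5 : (1 - a • x) * (1 - a • y) * (1 - a • x) = 1 - a • (x + x + y) +
        (a * a) • (x * y + y * x + x * x) - (a * a * a) • (x * y * x) := by
      simp only [sub_mul, mul_sub, smul_mul_assoc, mul_smul_comm, one_mul, mul_one]
      module
    have h6 : (a * a) • ((a + b) • x) = (a * a * a + a) • x := by
      rw [smul_smul]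
      congr 1
      linear_combination a * h3
    rw [h5, h1, h2, smul_add (a * a) (x * y + y * x), h6]
    module
  have h1 := tl_mul_mul i j
  have h2 := tl_mul_mul j i
  rw [form_adj h, form_adj' h] at h1 h2
  simp only [mul_neg, mul_one, neg_neg, one_smul] at h1 h2
  change (1 - (T 1 : ℤ[T;T⁻¹]) • tl i) * (1 - (T 1 : ℤ[T;T⁻¹]) • tl j) * (1 - (T 1 : ℤ[T;T⁻¹]) • tl i)
    = (1 - (T 1 : ℤ[T;T⁻¹]) • tl j) * (1 - (T 1 : ℤ[T;T⁻¹]) • tl i) * (1 - (T 1 : ℤ[T;T⁻¹]) • tl j)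
  rw [key _ _ (tl_mul_self i) h1, key _ _ (tl_mul_self j) h2, add_comm (tl i),
    add_comm (tl i * tl j)]

/-- The reduced Burau representation over `ℤ[s, s⁻¹]`, `t = s ^ 2`, in Squier's symmetric form. -/
noncomputable def burau {n : ℕ} :
    BraidGroup n →* (Matrix (Fin (n - 1)) (Fin (n - 1)) ℤ[T;T⁻¹])ˣ :=
  PresentedGroup.toGroup (f := burauGen) (by
    rintro r (⟨i, j, h, rfl⟩ | ⟨i, j, h, rfl⟩)
    · simp only [map_mul, map_inv, FreeGroup.lift_apply_of, mul_inv_eq_one]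
      exact burauGen_comm h
    · simp only [map_mul, map_inv, FreeGroup.lift_apply_of, mul_inv_eq_one]
      exact burauGen_braid h)

theorem burau_σ {n : ℕ} (i : Fin (n - 1)) :
    (burau (σ i : BraidGroup n) : Matrix _ _ ℤ[T;T⁻¹]) = 1 - (T 1 : ℤ[T;T⁻¹]) • tl i := by
  rw [burau, σ, PresentedGroup.toGroup.of]
  rfl

theorem burau_σ_inv {n : ℕ} (i : Fin (n - 1)) :
    (burau (σ i : BraidGroup n)⁻¹ : Matrix _ _ ℤ[T;T⁻¹]) =
      1 - (T (-1) : ℤ[T;T⁻¹]) • tl i := by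
  rw [map_inv, burau, σ, PresentedGroup.toGroup.of]
  rfl

theorem mirror_σ {n : ℕ} (i : Fin (n - 1)) : mirror (σ i : BraidGroup n) = (σ i)⁻¹ := by
  rw [mirror]
  conv_lhs => rw [σ]
  exact PresentedGroup.toGroup.of _

theorem mirror_mirror {n : ℕ} (g : BraidGroup n) : mirror (mirror g) = g := by
  have : (mirror.comp mirror : BraidGroup n →* BraidGroup n) = MonoidHom.id _ := by
    refine PresentedGroup.ext fun i => ?_
    have h := mirror_σ i
    rw [σ] at h
    simp [h]
  exact DFunLike.congr_fun this g

/-- The generator or inverse generator of a letter. -/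
def letter {n : ℕ} (l : Fin (n - 1) × Bool) : BraidGroup n := if l.2 then σ l.1 else (σ l.1)⁻¹

theorem toBraid_eq_prod {n : ℕ} (v : BraidWord n) : v.toBraid = (v.map letter).prod := by
  rw [BraidWord.toBraid]
  induction v with
  | nil => rfl
  | cons l v ih =>
    rw [List.map_cons, List.prod_cons, ← ih]
    have : FreeGroup.mk (l :: v) = FreeGroup.mk [l] * FreeGroup.mk v := by
      rw [FreeGroup.mul_mk]; rfl
    rw [this, map_mul]
    congr 1
    obtain ⟨i, _ | _⟩ := l
    · rfl
    · rfl

theorem exists_toBraid {n : ℕ} (g : BraidGroup n) : ∃ v : BraidWord n, v.toBraid = g := by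
  induction g using PresentedGroup.induction_on with
  | _ z => exact ⟨z.toWord, by rw [BraidWord.toBraid, FreeGroup.mk_toWord]⟩

theorem letter_induction {n : ℕ} {P : BraidGroup n → Prop} (one : P 1)
    (mul : ∀ l g, P g → P (letter l * g)) (g : BraidGroup n) : P g := by
  obtain ⟨v, rfl⟩ := exists_toBraid g
  rw [toBraid_eq_prod]
  induction v with
  | nil => exact one
  | cons l v ih => rw [List.map_cons, List.prod_cons]; exact mul _ _ ih

/-- `form`, and hence each `tl i`, is fixed by s ↦ 1/s, so this substitution only exchanges the
scalars s and 1/s that distinguish a generator from its inverse. -/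
theorem burau_mirror {n : ℕ} (g : BraidGroup n) :
    (burau (mirror g)).val = (burau g).val.map invert := by
  have htl : ∀ (k : ℕ) (i : Fin k), (tl i).map invert = tl i := by
    intro k i
    have := Matrix.map_mul (f := (invert : ℤ[T;T⁻¹] ≃ₐ[ℤ] ℤ[T;T⁻¹])) (L := single i i 1) (M := form k)
    rw [form_map_invert] at this
    rw [tl, this]
    congr 1
    ext1 a b
    simp only [map_apply, single_apply]
    split_ifs <;> simp
  have hgen : ∀ (k : ℕ) (i : Fin k) (a : ℤ), (1 - (T a : ℤ[T;T⁻¹]) • tl i).map invert =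
      1 - (T (-a) : ℤ[T;T⁻¹]) • tl i := by
    intro k i a
    ext1 x y
    have := congrFun (congrFun (htl k i) x) y
    simp only [map_apply] at this
    simp only [map_apply, Matrix.sub_apply, Matrix.smul_apply, smul_eq_mul, map_sub, map_mul, invert_T, this]
    congr 1
    rw [one_apply]
    split_ifs <;> simp
  induction g using letter_induction with
  | one => rw [map_one, map_one, Units.val_one, Matrix.map_one _ (map_zero _) (map_one _)]
  | mul l g ih =>
    have := Matrix.map_mul (f := (invert : ℤ[T;T⁻¹] ≃ₐ[ℤ] ℤ[T;T⁻¹]))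
      (L := (burau (letter l)).val) (M := (burau g).val)
    rw [map_mul, map_mul, map_mul, Units.val_mul, Units.val_mul, this, ih]
    congr 1
    obtain ⟨i, _ | _⟩ := l
    · simp only [letter, Bool.false_eq_true, if_false]
      rw [map_inv, mirror_σ, burau_σ_inv, hgen, inv_inv, burau_σ, neg_neg]
    · simp only [letter, if_true]
      rw [mirror_σ, burau_σ_inv, burau_σ, hgen]

/-- Each `tl i` is self-adjoint for `form`, so the transposed letter moves across `form` and meets
its own inverse, the mirrored letter. -/
theorem burau_form {n : ℕ} (g : BraidGroup n) :
    (burau g).valᵀ * form (n - 1) * (burau (mirror g)).val = form (n - 1) := by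
  have hgen : ∀ (k : ℕ) (i : Fin k) {a b : ℤ}, a + b = 0 → (a = 1 ∨ b = 1) →
      (1 - (T a : ℤ[T;T⁻¹]) • tl i)ᵀ * form k * (1 - (T b : ℤ[T;T⁻¹]) • tl i) = form k := by
    intro k i a b h h1
    have : (1 - (T a : ℤ[T;T⁻¹]) • tl i)ᵀ * form k = form k * (1 - (T a : ℤ[T;T⁻¹]) • tl i) := by
      rw [transpose_sub, transpose_smul, tl, transpose_mul, form_transpose, transpose_single,
        transpose_one, sub_mul, mul_sub, Matrix.mul_smul, Matrix.smul_mul, Matrix.mul_assoc]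
      simp
    rw [this, Matrix.mul_assoc, one_sub_tl_mul i h h1, Matrix.mul_one]
  induction g using letter_induction with
  | one => simp
  | mul l g ih =>
    have h : (burau (letter l)).valᵀ * form (n - 1) * (burau (mirror (letter l))).val
        = form (n - 1) := by
      obtain ⟨i, _ | _⟩ := l
      · simp only [letter, Bool.false_eq_true, if_false]
        rw [map_inv mirror, mirror_σ, burau_σ_inv, inv_inv, burau_σ]
        exact hgen _ _ (by norm_num) (by norm_num)
      · simp only [letter, if_true]
        rw [mirror_σ, burau_σ_inv, burau_σ]
        exact hgen _ _ (by norm_num) (by norm_num)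
    rw [map_mul, map_mul, map_mul, Units.val_mul, Units.val_mul, transpose_mul]
    calc _ = (burau g).valᵀ * ((burau (letter l)).valᵀ * form (n - 1) *
          (burau (mirror (letter l))).val) * (burau (mirror g)).val := by noncomm_ring
      _ = _ := by rw [h, ih]

theorem det_one_sub_smul_tl {k : ℕ} (i : Fin k) (x : ℤ[T;T⁻¹]) :
    (1 - x • tl i).det = 1 - x * (T 1 + T (-1)) := by
  have h : 1 - x • tl i = (1 : Matrix (Fin k) (Fin k) ℤ[T;T⁻¹]).updateRow i
      (Pi.single i 1 - x • form k i) := by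
    ext1 a b
    by_cases ha : a = i
    · subst ha
      simp [tl, one_apply, Pi.single_apply, eq_comm]
    · simp [tl, ha]
  rw [h]
  rw [← cramer_transpose_apply, cramer_eq_adjugate_mulVec]
  simp [form_self]

/-- A letter contributes −s^{±2}. What matters later is that the power of s is a square. -/
theorem det_burau {n : ℕ} (g : BraidGroup n) :
    ∃ (e : ℤˣ) (j : ℤ), (burau g).val.det = (e : ℤ) • (T j * T j : ℤ[T;T⁻¹]) := by
  induction g using letter_induction with
  | one => exact ⟨1, 0, by simp⟩
  | mul l g ih =>
    obtain ⟨e, j, h⟩ := ih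
    obtain ⟨i, _ | _⟩ := l
    · refine ⟨-e, j - 1, ?_⟩
      simp only [letter, Bool.false_eq_true, if_false]
      rw [map_mul, Units.val_mul, burau_σ_inv, det_mul, h, det_one_sub_smul_tl, mul_add, ← T_add,
        ← T_add, ← T_add, ← T_add]
      simp
      left; congr 1; ring
    · refine ⟨-e, j + 1, ?_⟩
      simp only [letter, if_true]
      rw [map_mul, Units.val_mul, burau_σ, det_mul, h, det_one_sub_smul_tl, mul_add, ← T_add,
        ← T_add, ← T_add, ← T_add]
      simp
      left; congr 1; ring

/-- The quantum integer `(sⁿ - s⁻ⁿ) / (s - s⁻¹)`. -/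
noncomputable def quantumInt (n : ℕ) : ℤ[T;T⁻¹] := ∑ i ∈ Finset.range n, T (2 * i - (n - 1))

theorem sub_mul_quantumInt (n : ℕ) :
    (T 1 - T (-1)) * quantumInt n = (T n - T (-n) : ℤ[T;T⁻¹]) := by
  have : ∀ m ≤ n, (T 1 - T (-1)) * ∑ i ∈ Finset.range m, T (2 * i - (n - 1)) =
      (T (2 * m - n) - T (-n) : ℤ[T;T⁻¹]) := by
    intro m hm
    induction m with
    | zero => simp
    | succ m ih =>
      rw [Finset.sum_range_succ, mul_add, ih (by omega), sub_mul, ← T_add, ← T_add]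
      rw [show (1 + (2 * m - (n - 1)) : ℤ) = 2 * (m + 1 : ℕ) - n by push_cast; ring,
        show (-1 + (2 * m - (n - 1)) : ℤ) = 2 * m - n by ring]
      ring
  rw [quantumInt, this n le_rfl]
  congr 2; ring

theorem T_one_sub_T_neg_one_ne_zero : (T 1 - T (-1) : ℤ[T;T⁻¹]) ≠ 0 := by
  intro h
  have := congrArg (fun p => p.coeff 1) h
  simp at this

theorem quantumInt_add_two (n : ℕ) :
    quantumInt (n + 2) = (T 1 + T (-1)) * quantumInt (n + 1) - quantumInt n := by
  apply mul_left_cancel₀ T_one_sub_T_neg_one_ne_zero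
  rw [mul_sub, mul_left_comm, sub_mul_quantumInt, sub_mul_quantumInt, sub_mul_quantumInt, mul_sub,
    add_mul, add_mul, ← T_add, ← T_add, ← T_add, ← T_add]
  rw [show (1 + (n + 1 : ℕ) : ℤ) = (n + 2 : ℕ) by push_cast; ring,
    show (1 + -(n + 1 : ℕ) : ℤ) = -n by push_cast; ring,
    show (-1 + (n + 1 : ℕ) : ℤ) = n by push_cast; ring,
    show (-1 + -(n + 1 : ℕ) : ℤ) = -(n + 2 : ℕ) by push_cast; ring]
  ring

/-- The matrix is tridiagonal, and expanding along the first row gives the recurrence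
`quantumInt_add_two`. -/
theorem det_form (k : ℕ) : (form k).det = quantumInt (k + 1) := by
  induction k using Nat.twoStepInduction with
  | zero => simp [quantumInt]
  | one => simp [quantumInt, form, Finset.sum_range_succ, add_comm]
  | more k ih1 ih2 =>
    rw [quantumInt_add_two, ← ih1, ← ih2, det_succ_row_zero, Fin.sum_univ_succ, Fin.sum_univ_succ]
    have h0 : ∀ i : Fin k, form (k + 2) 0 i.succ.succ = 0 := fun i => form_far (by simp)
    have h1 : (form (k + 2)).submatrix Fin.succ (Fin.succAbove 0) = form (k + 1) := by
      ext1 i j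
      simp [form, Fin.ext_iff]
    have h2 : (((form (k + 2)).submatrix Fin.succ (Fin.succAbove (Fin.succ 0))).det) =
        - (form k).det := by
      rw [det_succ_column_zero, Fin.sum_univ_succ]
      have h3 : ∀ i : Fin k, (form (k + 2)).submatrix Fin.succ (Fin.succAbove (Fin.succ 0))
          i.succ 0 = 0 := fun i => by
        rw [submatrix_apply, show (Fin.succ (0 : Fin (k + 1))).succAbove 0 = 0 from rfl]
        exact form_far' (by simp)
      have h4 : ((form (k + 2)).submatrix Fin.succ (Fin.succAbove (Fin.succ 0))).submatrix
          (Fin.succAbove 0) Fin.succ = form k := by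
        ext1 i j
        simp [form, Fin.ext_iff]
      have h5 : (form (k + 2)).submatrix Fin.succ (Fin.succAbove (Fin.succ 0)) 0 0 = -1 := by
        rw [submatrix_apply, show (Fin.succ (0 : Fin (k + 1))).succAbove 0 = 0 from rfl]
        exact form_adj' (by simp)
      rw [Finset.sum_eq_zero fun i _ => by rw [h3]; ring, h4, h5]
      simp
    rw [Finset.sum_eq_zero fun i _ => by rw [h0]; ring, h1, h2, form_self,
      form_adj (i := (0 : Fin (k + 2))) (j := Fin.succ 0) (by simp)]
    simp
    ring

end BraidGroup

/-! ### The Alexander matrix of a closed braid and the unreduced Burau matrices -/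

open Matrix in
theorem LinkDiagram.alexanderMatrix_apply (D : LinkDiagram) (e e' : D.Edge) :
    D.alexanderMatrix e e' = (if D.next e = e' then 1 else 0) - (if e = e' then 1 else 0) +
      ∑ c, if D.lower c = e then (1 - T (D.sign c : ℤ) : ℤ[T;T⁻¹]) *
        ((if e = e' then 1 else 0) - if D.upper c = e' then 1 else 0) else 0 := by
  rw [alexanderMatrix, of_apply, Finset.sum_filter]
  simp only [Pi.add_apply, Pi.sub_apply, Finset.sum_apply, Pi.single_apply]
  congr 1
  · congr 1 <;> exact if_congr eq_comm rfl rfl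
  · refine Finset.sum_congr rfl fun c _ => ?_
    by_cases h : D.lower c = e
    · rw [if_pos h, if_pos h]
      simp only [Pi.smul_apply, Pi.sub_apply, Pi.single_apply, smul_eq_mul]
      congr 2 <;> exact if_congr eq_comm rfl rfl
    · rw [if_neg h, if_neg h]
      rfl

namespace BraidWord

open Matrix

variable {n : ℕ}

/-- The unreduced Burau matrix of a letter. -/
noncomputable def letterMatrix (l : Fin (n - 1) × Bool) : Matrix (Fin n) (Fin n) ℤ[T;T⁻¹] :=
  1 + vecMulVec
    (T (if l.2 then 1 else 0) • Pi.single (left l.1) 1 -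
      T (if l.2 then 0 else -1) • Pi.single (right l.1) 1)
    (Pi.single (right l.1) 1 - Pi.single (left l.1) 1)

theorem letterMatrix_mulVec_one (l : Fin (n - 1) × Bool) : letterMatrix l *ᵥ 1 = 1 := by
  rw [letterMatrix, add_mulVec, vecMulVec_mulVec, sub_dotProduct]
  simp

theorem vecMul_letterMatrix (l : Fin (n - 1) × Bool) :
    (fun p : Fin n => (T p : ℤ[T;T⁻¹])) ᵥ* letterMatrix l = fun p : Fin n => T p := by
  rw [letterMatrix, vecMul_add, vecMul_one, vecMul_vecMulVec, dotProduct_sub, dotProduct_smul,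
    dotProduct_smul, dotProduct_single_one, dotProduct_single_one, smul_eq_mul, smul_eq_mul,
    ← T_add, ← T_add]
  have h : ((if l.2 then 1 else 0) + (left l.1).val : ℤ) =
      (if l.2 then 0 else -1) + (right l.1).val := by
    obtain ⟨i, _ | _⟩ := l
    · simp [left, right]
    · simp [left, right, add_comm]
  rw [h, sub_self, zero_smul, add_zero]

/-- The unreduced Burau matrix of the step from level `j` to the next one. -/
noncomputable def stepMatrix (v : BraidWord n) (j : ℕ) : Matrix (Fin n) (Fin n) ℤ[T;T⁻¹] :=
  if h : j < v.length then letterMatrix v[j] else 1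

theorem stepMatrix_mulVec_one (v : BraidWord n) (j : ℕ) : stepMatrix v j *ᵥ 1 = 1 := by
  rw [stepMatrix]
  split_ifs
  · exact letterMatrix_mulVec_one _
  · exact one_mulVec _

theorem vecMul_stepMatrix (v : BraidWord n) (j : ℕ) :
    (fun p : Fin n => (T p : ℤ[T;T⁻¹])) ᵥ* stepMatrix v j = fun p : Fin n => T p := by
  rw [stepMatrix]
  split_ifs
  · exact vecMul_letterMatrix _
  · exact vecMul_one _

theorem letterMatrix_apply (i : Fin (n - 1)) (b : Bool) (p r : Fin n) :
    letterMatrix (i, b) (Equiv.swap (left i) (right i) p) r =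
      (if p = r then 1 else 0) - if (if b then right i else left i) = p then
        (1 - T (if b then 1 else -1)) *
          ((if p = r then 1 else 0) - if (if b then left i else right i) = r then 1 else 0)
      else 0 := by
  have hne := left_ne_right i
  by_cases hl : p = left i
  · subst hl
    rw [Equiv.swap_apply_left]
    cases b <;> simp [letterMatrix, vecMulVec_apply, Matrix.one_apply, Pi.single_apply, hne, hne.symm,
      eq_comm] <;> ring
  by_cases hr : p = right i
  · subst hr
    rw [Equiv.swap_apply_right]
    cases b <;> simp [letterMatrix, vecMulVec_apply, Matrix.one_apply, Pi.single_apply, hne, hne.symm,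
      eq_comm] <;> ring
  rw [Equiv.swap_apply_of_ne_of_ne hl hr]
  cases b <;> simp [letterMatrix, vecMulVec_apply, Matrix.one_apply, Pi.single_apply, hl, hr,
    Ne.symm hl, Ne.symm hr]

/-- The Wirtinger relation at `e` expresses the generator at `next e` through those on the level of
`e`. Indexing rows by `next e` therefore gives the cyclic system; the last level, which has no
letter, contributes an identity block. -/
theorem alexanderMatrix_closure (v : BraidWord n) :
    v.closure.alexanderMatrix =
      (cyclicBlock v.length (stepMatrix v)).submatrix v.closure.next id := by
  ext1 ⟨j, p⟩ ⟨k, r⟩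
  let lo (c : Fin v.length) : Fin (v.length + 1) × Fin n :=
    (c.castSucc, if v[c].2 then right v[c].1 else left v[c].1)
  let up (c : Fin v.length) : Fin (v.length + 1) × Fin n :=
    (c.castSucc, if v[c].2 then left v[c].1 else right v[c].1)
  have hA : v.closure.alexanderMatrix (j, p) (k, r) =
      (if (j + 1, v.stepPerm j p) = (k, r) then 1 else 0) - (if (j, p) = (k, r) then 1 else 0) +
      ∑ c : Fin v.length, if lo c = (j, p) then
        (1 - T (v.closure.sign c : ℤ) : ℤ[T;T⁻¹]) * ((if (j, p) = (k, r) then 1 else 0) -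
          if up c = (k, r) then 1 else 0) else 0 := by
    have hn : v.closure.next (j, p) = (j + 1, v.stepPerm j p) := by
      change (finRotate _ j, _) = _
      rw [finRotate_apply]
    have h := v.closure.alexanderMatrix_apply (j, p) (k, r)
    rw [hn] at h
    exact h
  have hB : (cyclicBlock v.length (stepMatrix v)).submatrix v.closure.next id (j, p) (k, r) =
      (if (j + 1, v.stepPerm j p) = (k, r) then 1 else 0) -
        if j = k then stepMatrix v j (v.stepPerm j p) r else 0 := by
    change cyclicBlock v.length (stepMatrix v) (finRotate _ j, v.stepPerm j p) (k, r) = _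
    rw [finRotate_apply, cyclicBlock, of_apply]
    simp only [add_left_inj]
    congr 1
    split_ifs with h
    · rw [h]
    · rfl
  rw [hA, hB, sub_add, sub_right_inj]
  induction j using Fin.lastCases with
  | last =>
    rw [Finset.sum_eq_zero, sub_zero]
    · simp [stepMatrix, stepPerm, one_apply, ite_and]
    · intro c _
      rw [if_neg]
      intro h
      exact (Fin.castSucc_lt_last c).ne (congrArg Prod.fst h)
  | cast c =>
    rw [Finset.sum_eq_single c]
    · have h1 : stepMatrix v c.castSucc = letterMatrix (v[c].1, v[c].2) := by
        simp [stepMatrix]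
      have h2 : v.stepPerm c.castSucc = Equiv.swap (left v[c].1) (right v[c].1) := by
        simp [stepPerm]
      rw [h1, h2, letterMatrix_apply]
      have h5 : ((v.closure.sign c : ℤˣ) : ℤ) = if v[c].2 then 1 else -1 := by
        change (((if v[c].2 then 1 else -1 : ℤˣ)) : ℤ) = _
        split_ifs <;> rfl
      rw [h5]
      simp only [lo, up]
      by_cases hk : c.castSucc = k
      · simp only [Prod.mk.injEq, hk, true_and, if_true]
      · simp only [Prod.mk.injEq, hk, false_and, if_false, sub_self, mul_zero, ite_self]
    · intro d _ hd
      rw [if_neg]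
      intro h
      exact hd (Fin.castSucc_injective _ (congrArg Prod.fst h))
    · simp

theorem alexanderMatrix_closure_mulVec_one (v : BraidWord n) :
    v.closure.alexanderMatrix *ᵥ 1 = 0 := by
  have h : ∀ a, (cyclicBlock v.length (stepMatrix v) *ᵥ 1) a = 0 := by
    rintro ⟨a, p⟩
    have h1 : ∀ c : Fin (v.length + 1), a = c + 1 ↔ c = a - 1 := fun c => by
      rw [eq_sub_iff_add_eq, eq_comm]
    have h2 := congrFun (stepMatrix_mulVec_one v (a - 1 : Fin (v.length + 1))) p
    simp only [mulVec, dotProduct, Pi.one_apply, mul_one] at h2 ⊢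
    simp only [cyclicBlock, of_apply, Finset.sum_sub_distrib, Fintype.sum_prod_type]
    simp [h1, h2, Prod.ext_iff, ite_and]
  rw [alexanderMatrix_closure]
  ext1 e
  exact h (v.closure.next e)

theorem vecMul_alexanderMatrix_closure (v : BraidWord n) :
    (fun e : v.closure.Edge => (T (v.closure.next e).2.val : ℤ[T;T⁻¹])) ᵥ*
      v.closure.alexanderMatrix = 0 := by
  have h : ∀ b, ((fun a : Fin (v.length + 1) × Fin n => (T a.2.val : ℤ[T;T⁻¹])) ᵥ*
      cyclicBlock v.length (stepMatrix v)) b = 0 := by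
    rintro ⟨b, p⟩
    have h2 := congrFun (vecMul_stepMatrix v b) p
    simp only [vecMul, dotProduct] at h2 ⊢
    simp only [cyclicBlock, of_apply, mul_sub, Finset.sum_sub_distrib, Fintype.sum_prod_type]
    simp only [mul_comm (T _)] at h2
    simp [h2, Prod.ext_iff, ite_and, mul_comm (T _)]
  rw [alexanderMatrix_closure]
  ext1 b
  refine Eq.trans ?_ (h b)
  exact Equiv.sum_comp v.closure.next
    (fun a => (T a.2.val : ℤ[T;T⁻¹]) * cyclicBlock v.length (stepMatrix v) a b)

end BraidWord

theorem LinkDiagram.substSq_T (k : ℤ) : substSq (T k) = T (2 * k) := by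
  simp only [substSq, T, AddMonoidAlgebra.mapDomainRingHom_apply]
  exact AddMonoidAlgebra.mapDomain_single

/-! ### From the unreduced to the reduced Burau matrices -/

namespace BraidWord

open Matrix BraidGroup LinkDiagram

variable {n : ℕ}

/-- The coordinates `sⁱ (xᵢ - xᵢ₊₁)` which relate the unreduced to the reduced Burau matrices. -/
noncomputable def diffMatrix (n : ℕ) : Matrix (Fin (n - 1)) (Fin n) ℤ[T;T⁻¹] :=
  of fun i => (T i.val : ℤ[T;T⁻¹]) • (Pi.single (left i) 1 - Pi.single (right i) 1 : Fin n → ℤ[T;T⁻¹])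

theorem diffMatrix_mulVec_one (n : ℕ) : diffMatrix n *ᵥ 1 = 0 := by
  ext1 i
  change ((T i.val : ℤ[T;T⁻¹]) • (Pi.single (left i) 1 - Pi.single (right i) 1 :
    Fin n → ℤ[T;T⁻¹])) ⬝ᵥ 1 = 0
  rw [smul_dotProduct, sub_dotProduct]
  simp

theorem letterMatrix_map_substSq (l : Fin (n - 1) × Bool) :
    (letterMatrix l).map substSq = 1 + vecMulVec
      (T (if l.2 then 2 else 0) • Pi.single (left l.1) 1 -
        T (if l.2 then 0 else -2) • Pi.single (right l.1) 1)
      (Pi.single (right l.1) 1 - Pi.single (left l.1) 1) := by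
  have h : ∀ i j : Fin n, substSq ((Pi.single i 1 : Fin n → ℤ[T;T⁻¹]) j) =
      (Pi.single i 1 : Fin n → ℤ[T;T⁻¹]) j := by
    intro i j
    rw [Pi.single_apply]
    split_ifs <;> simp
  ext1 p q
  simp only [letterMatrix, map_apply, Matrix.add_apply, vecMulVec_apply, Pi.sub_apply,
    Pi.smul_apply, smul_eq_mul, map_add, map_mul, map_sub, h, substSq_T]
  congr 1
  · rw [one_apply]
    split_ifs <;> simp
  · obtain ⟨i, _ | _⟩ := l <;> simp

theorem burau_letter (l : Fin (n - 1) × Bool) :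
    (burau (letter l : BraidGroup n)).val =
      1 - (T (if l.2 then 1 else -1) : ℤ[T;T⁻¹]) • tl l.1 := by
  obtain ⟨i, _ | _⟩ := l
  · exact burau_σ_inv i
  · exact burau_σ i

/-- Differences of neighbouring coordinates quotient out the fixed vector 1, and the weights s^i put
the result into Squier's symmetric coordinates. The transpose reverses products, as `revProd`
requires. -/
theorem diffMatrix_mul_letterMatrix (l : Fin (n - 1) × Bool) :
    diffMatrix n * (letterMatrix l).map substSq =
      (burau (letter l : BraidGroup n)).valᵀ * diffMatrix n := by
  obtain ⟨i, b⟩ := l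
  rw [letterMatrix_map_substSq, burau_letter, transpose_sub, transpose_one, transpose_smul, tl,
    transpose_mul, form_transpose, transpose_single, Matrix.mul_add, Matrix.mul_one, Matrix.sub_mul,
    Matrix.one_mul, mul_vecMulVec, sub_eq_add_neg (diffMatrix n)]
  congr 1
  have h : diffMatrix n *ᵥ (T (if b then 2 else 0) • Pi.single (left i) 1 -
      T (if b then 0 else -2) • Pi.single (right i) 1) =
      (T (if b then 1 else -1) * T i.val : ℤ[T;T⁻¹]) • (form (n - 1)).col i := by
    ext1 p
    have hl : ∀ p q : Fin (n - 1), left p = left q ↔ p.val = q.val := by simp [left]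
    have hr : ∀ p q : Fin (n - 1), right p = right q ↔ p.val = q.val := by simp [right]
    have hlr : ∀ p q : Fin (n - 1), left p = right q ↔ p.val = q.val + 1 := by simp [left, right]
    have hrl : ∀ p q : Fin (n - 1), right p = left q ↔ p.val + 1 = q.val := by simp [left, right]
    rw [mulVec_sub, mulVec_smul, mulVec_smul, mulVec_single_one, mulVec_single_one]
    simp only [Pi.sub_apply, Pi.smul_apply, col_apply, diffMatrix, of_apply, smul_eq_mul,
      Pi.single_apply, form, @eq_comm _ (left i), @eq_comm _ (right i), hl, hr, hlr, hrl, Fin.ext_iff]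
    have h1m : (T 1 * T (-1) : ℤ[T;T⁻¹]) = 1 := by rw [← T_add]; simp
    have h20 : (T 2 : ℤ[T;T⁻¹]) = T 1 * T 1 := by rw [← T_add]; rfl
    have h2m : (T (-2) : ℤ[T;T⁻¹]) = T (-1) * T (-1) := by rw [← T_add]; rfl
    by_cases h1 : p.val = i.val
    · simp only [h1, if_true, left_eq_add, add_eq_left, one_ne_zero, if_false, sub_zero, mul_one,
        zero_sub]
      cases b <;> simp only [if_true, if_false, Bool.false_eq_true, T_zero, h20, h2m]
      · linear_combination (-T i.val : ℤ[T;T⁻¹]) * h1m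
      · linear_combination (-T i.val : ℤ[T;T⁻¹]) * h1m
    by_cases h2 : p.val = i.val + 1
    · have h3 : (T p.val : ℤ[T;T⁻¹]) = T i.val * T 1 := by rw [h2, ← T_add]; rfl
      have h4 : ¬ p.val + 1 = i.val := by omega
      simp only [h1, h4, h2.symm, h3, if_true, if_false, sub_zero, or_true]
      cases b <;> simp only [if_true, if_false, Bool.false_eq_true, T_zero, h20, h2m]
      · linear_combination (-(T i.val * T (-1)) : ℤ[T;T⁻¹]) * h1m
      · ring
    by_cases h3 : p.val + 1 = i.val
    · have h4 : (T i.val : ℤ[T;T⁻¹]) = T p.val * T 1 := by rw [← h3, ← T_add]; rfl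
      simp only [h1, h2, h3, h4, if_true, if_false, sub_zero, true_or]
      cases b <;> simp only [if_true, if_false, Bool.false_eq_true, T_zero, h20, h2m]
      · linear_combination (T p.val : ℤ[T;T⁻¹]) * h1m
      · ring
    · have h2' : ¬ i.val + 1 = p.val := fun h => h2 h.symm
      simp only [h1, h2, h2', h3, if_false, or_self, sub_zero, mul_zero]
  rw [h]
  ext1 p q
  have h2 : (form (n - 1) * single i i (1 : ℤ[T;T⁻¹]) * diffMatrix n) p q =
      form (n - 1) p i * diffMatrix n i q := by
    rw [mul_apply, Finset.sum_eq_single i]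
    · simp
    · intro a _ ha
      rw [mul_single_apply_of_ne _ _ _ _ _ ha, zero_mul]
    · simp
  rw [Matrix.neg_apply, Matrix.smul_mul, Matrix.smul_apply, h2]
  simp only [vecMulVec_apply, Pi.smul_apply, col_apply, diffMatrix, of_apply, smul_eq_mul,
    Pi.sub_apply]
  ring

theorem diffMatrix_mul_revProd (v : BraidWord n) (j : ℕ) (hj : j ≤ v.length) :
    diffMatrix n * (revProd (stepMatrix v) j).map substSq =
      (burau (toBraid (v.take j))).valᵀ * diffMatrix n := by
  rw [toBraid_eq_prod]
  induction j with
  | zero => simp [revProd, Matrix.map_one _ (map_zero substSq) (map_one substSq)]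
  | succ j ih =>
    have hj' : j < v.length := hj
    rw [revProd, Matrix.map_mul, ← Matrix.mul_assoc]
    simp only [stepMatrix, dif_pos hj']
    rw [diffMatrix_mul_letterMatrix, Matrix.mul_assoc, ih hj'.le, List.take_succ_eq_append_getElem hj',
      List.map_append, List.prod_append, map_mul, Units.val_mul, transpose_mul, Matrix.mul_assoc]
    simp

/-- The added matrix 1·e₀ᵀ repairs the kernel vector of 1 − B: the sum X fixes 1. In the coordinates
given by x₀ and the rows of `diffMatrix`, the vector 1 becomes e₀, so X has first column e₀ and
lower right block 1 − S. -/
theorem det_one_sub_add_eq {B : Matrix (Fin n) (Fin n) ℤ[T;T⁻¹]}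
    {S : Matrix (Fin (n - 1)) (Fin (n - 1)) ℤ[T;T⁻¹]} (hn : 0 < n) (hB : B *ᵥ 1 = 1)
    (h : diffMatrix n * B = S * diffMatrix n) :
    (1 - B + of fun _ q : Fin n => if q.val = 0 then 1 else 0).det = (1 - S).det := by
  obtain ⟨k, rfl⟩ : ∃ k, n = k + 1 := ⟨n - 1, by omega⟩
  change Matrix (Fin k) (Fin k) ℤ[T;T⁻¹] at S
  set X : Matrix (Fin (k + 1)) (Fin (k + 1)) ℤ[T;T⁻¹] :=
    1 - B + of fun _ q : Fin (k + 1) => if q.val = 0 then 1 else 0 with hX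
  let D : Matrix (Fin k) (Fin (k + 1)) ℤ[T;T⁻¹] := diffMatrix (k + 1)
  have hD1 : D *ᵥ 1 = 0 := diffMatrix_mulVec_one (k + 1)
  have hDB : D * B = S * D := h
  let Q : Matrix (Fin (k + 1)) (Fin (k + 1)) ℤ[T;T⁻¹] := 
    of (Fin.cons (α := fun _ => Fin (k + 1) → ℤ[T;T⁻¹]) (Pi.single 0 1) D)
  have hQ0 : ∀ j, Q 0 j = (Pi.single 0 1 : Fin (k + 1) → ℤ[T;T⁻¹]) j := fun j => rfl
  have hQs : ∀ i j, Q i.succ j = D i j := fun i j => rfl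
  have hD : ∀ i j, D i j = T i.val * ((Pi.single i.castSucc 1 : Fin (k + 1) → ℤ[T;T⁻¹]) j -
      (Pi.single i.succ 1 : Fin (k + 1) → ℤ[T;T⁻¹]) j) := fun i j => rfl
  have hQ : IsUnit Q.det := by
    rw [det_of_isLowerTriangular]
    · refine IsUnit.prod_univ_iff.mpr fun i => ?_
      cases i using Fin.cases with
      | zero => simp [hQ0]
      | succ i =>
        have : Q i.succ i.succ = - T i.val := by
          rw [hQs, hD]
          simp [Fin.ext_iff]
        rw [this]
        exact (isUnit_T _).neg
    · intro i j hij
      have hij : i < j := hij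
      cases i using Fin.cases with
      | zero => simp [hQ0, hij.ne']
      | succ i =>
        rw [hQs, hD, Pi.single_apply, Pi.single_apply]
        rw [Fin.lt_def, Fin.val_succ] at hij
        rw [if_neg, if_neg, sub_self, mul_zero]
        · rw [Fin.ext_iff, Fin.val_succ]; omega
        · rw [Fin.ext_iff, Fin.val_castSucc]; omega
  have hX1 : X *ᵥ 1 = 1 := by
    rw [hX, add_mulVec, sub_mulVec, one_mulVec, hB, sub_self, zero_add]
    ext1 i
    simp [mulVec, dotProduct]
  have hQ1 : Q *ᵥ 1 = Pi.single 0 1 := by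
    ext1 i
    cases i using Fin.cases with
    | zero => simp [hQ0, mulVec]
    | succ i => simpa [hQs, mulVec] using congrFun hD1 i
  have hDX : D * X = (1 - S) * D := by
    have : D * of (fun _ q : Fin (k + 1) => if q.val = 0 then (1 : ℤ[T;T⁻¹]) else 0) = 0 := by
      ext1 i j
      have := congrFun hD1 i
      simp only [mulVec, dotProduct, Pi.one_apply, mul_one, Pi.zero_apply] at this
      rw [mul_apply]
      simp only [of_apply]
      rw [← Finset.sum_mul, this, zero_mul]
      rfl
    rw [hX, Matrix.mul_add, this, Matrix.mul_sub, hDB, Matrix.sub_mul]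
    simp
  let w : Fin (k + 1) → ℤ[T;T⁻¹] := (X 0) ᵥ* Q⁻¹
  let Y : Matrix (Fin (k + 1)) (Fin (k + 1)) ℤ[T;T⁻¹] :=
    of (Fin.cons (α := fun _ => Fin (k + 1) → ℤ[T;T⁻¹]) w fun i => Fin.cons 0 ((1 - S) i))
  have hYQ : Y * Q = Q * X := by
    ext1 i j
    cases i using Fin.cases with
    | zero =>
      have h1 : (w ᵥ* Q) j = X 0 j := by
        rw [vecMul_vecMul, nonsing_inv_mul _ hQ, vecMul_one]
      have h2 : (Pi.single (0 : Fin (k + 1)) (1 : ℤ[T;T⁻¹]) ᵥ* X) j = X 0 j := by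
        rw [single_one_vecMul]
        rfl
      exact h1.trans h2.symm
    | succ i =>
      have h1 : (Q * X) i.succ j = (D * X) i j := rfl
      rw [h1, hDX, mul_apply, Fin.sum_univ_succ, mul_apply]
      simp [Y, hQs]
  have hdet : X.det = Y.det := by
    have := congrArg det hYQ
    rw [det_mul, det_mul, mul_comm] at this
    exact (hQ.mul_left_cancel this).symm
  have hw : w 0 = 1 := by
    have h1 : (Y * Q) *ᵥ 1 = Pi.single 0 1 := by
      rw [hYQ, ← mulVec_mulVec, hX1, hQ1]
    rw [← mulVec_mulVec, hQ1, mulVec_single_one] at h1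
    have := congrFun h1 0
    simpa [Y] using this
  rw [hdet, det_succ_column_zero, Fin.sum_univ_succ, Finset.sum_eq_zero]
  · have h2 : Y.submatrix (Fin.succAbove 0) Fin.succ = 1 - S := by
      ext1 i j
      simp [Y]
    rw [h2]
    have h3 : Y 0 0 = 1 := hw
    rw [h3]
    simp
  · intro i _
    have h3 : Y i.succ 0 = 0 := rfl
    rw [h3]
    ring

end BraidWord

/-! ### The value of Δ at t = 1 and the Burau formula for Δ -/

/-- The evaluation of an integral Laurent polynomial at `1`. -/
noncomputable def LaurentPolynomial.evalOne : ℤ[T;T⁻¹] →+* ℤ := eval₂ (RingHom.id ℤ) 1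

@[simp]
theorem LaurentPolynomial.evalOne_T (k : ℤ) : evalOne (T k) = 1 := by
  simp [evalOne, eval₂_T]

namespace LinkDiagram

open Matrix

/-- At t = 1 the matrix is a permutation matrix minus the identity. If a prime p divided the minor,
some nonzero vector modulo p would vanish at `e` and be constant along the single cycle of `next`.
-/
theorem isUnit_evalOne_adjugate (D : LinkDiagram) (hD : D.IsKnot) (e : D.Edge) :
    IsUnit (evalOne (D.alexanderMatrix.adjugate e e)) := by
  rw [Int.isUnit_iff_natAbs_eq]
  by_contra h
  obtain ⟨p, hp, hdvd⟩ := Nat.exists_prime_and_dvd h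
  have := Fact.mk hp
  let f : ℤ[T;T⁻¹] →+* ZMod p := (Int.castRingHom (ZMod p)).comp evalOne
  have hf : f (D.alexanderMatrix.adjugate e e) = 0 := by
    change ((evalOne (D.alexanderMatrix.adjugate e e) : ℤ) : ZMod p) = 0
    rw [ZMod.intCast_zmod_eq_zero_iff_dvd]
    exact Int.natCast_dvd.mpr hdvd
  have hA : ∀ a b, f (D.alexanderMatrix a b) =
      (if D.next a = b then 1 else 0) - if a = b then 1 else 0 := by
    intro a b
    rw [alexanderMatrix_apply]
    have h0 : ∀ k, f (T k) = 1 := fun k => by simp [f]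
    rw [map_add, map_sum, Finset.sum_eq_zero, add_zero, map_sub]
    · congr 1 <;> split_ifs <;> simp
    · intro c _
      split_ifs <;> simp [h0]
  have h1 : f (D.alexanderMatrix.adjugate e e) = (f.mapMatrix D.alexanderMatrix).adjugate e e := by
    rw [← RingHom.map_adjugate]
    rfl
  rw [h1, adjugate_apply] at hf
  obtain ⟨x, hx, hx0⟩ := exists_mulVec_eq_zero_iff.mpr hf
  have hrow : ∀ a, a ≠ e → x (D.next a) - x a = 0 := by
    intro a ha
    have := congrFun hx0 a
    simpa [mulVec, dotProduct, updateRow_ne ha, hA, sub_mul] using this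
  have hxe : x e = 0 := by
    have := congrFun hx0 e
    simpa [mulVec, dotProduct, Pi.single_apply] using this
  -- The differences sum to zero, which recovers the equation lost in the row of `e`.
  have hsum : ∑ a, (x (D.next a) - x a) = 0 := by
    rw [Finset.sum_sub_distrib, Equiv.sum_comp D.next x, sub_self]
  have hall : ∀ a, x (D.next a) = x a := by
    intro a
    by_cases ha : a = e
    · subst ha
      rw [Finset.sum_eq_single a (fun b _ hb => hrow b hb) (by simp)] at hsum
      exact sub_eq_zero.mp hsum
    · exact sub_eq_zero.mp (hrow a ha)
  apply hx
  ext1 a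
  obtain ⟨i, -, rfl⟩ := (hD.2 e a).exists_pow_eq'
  induction i with
  | zero => simpa using hxe
  | succ i ih => rw [pow_succ', Equiv.Perm.mul_apply, hall]; exact ih

end LinkDiagram

namespace BraidWord

open Matrix BraidGroup LinkDiagram

/-- The left kernel vector (powers of t by position) and the right kernel vector 1 determine the
adjugate up to one scalar, which thus generates the ideal of minors. -/
theorem adjugate_alexanderMatrix_closure {n : ℕ} (v : BraidWord n) (e₀ : v.closure.Edge) :
    ∃ c, ∀ e e', v.closure.alexanderMatrix.adjugate e e' =
      c * T ((v.closure.next e').2.val : ℤ) := by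
  refine ⟨v.closure.alexanderMatrix.adjugate e₀ e₀ * T (-(v.closure.next e₀).2.val), ?_⟩
  intro e e'
  rw [adjugate_eq_of_mulVec_one_eq_zero v.alexanderMatrix_closure_mulVec_one e e₀ e']
  have h := adjugate_mul_of_vecMul_eq_zero v.vecMul_alexanderMatrix_closure e₀ e' e₀
  have h1 : (T ((v.closure.next e₀).2.val : ℤ) * T (-(v.closure.next e₀).2.val) : ℤ[T;T⁻¹]) = 1 := by
    rw [← T_add]; simp
  linear_combination (T (-(v.closure.next e₀).2.val : ℤ) : ℤ[T;T⁻¹]) * h -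
    (v.closure.alexanderMatrix.adjugate e₀ e') * h1

theorem revProd_mulVec_one {n : ℕ} (v : BraidWord n) (j : ℕ) :
    revProd (stepMatrix v) j *ᵥ 1 = 1 := by
  induction j with
  | zero => exact one_mulVec _
  | succ j ih => rw [revProd, ← mulVec_mulVec, ih, stepMatrix_mulVec_one]

/-- The determinant of A + a·e₀ᵀ, with a the indicator of the edges whose successor lies on level 0,
is computed twice: through the adjugate it is c·(1 + t + ⋯ + t^(n−1)), and through the cyclic block
formula it reduces to the Burau determinant. The sign is that of the row permutation `next`. -/
theorem substSq_mul_sum {n : ℕ} (hn : 0 < n) (v : BraidWord n) {c : ℤ[T;T⁻¹]}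
    (hc : ∀ e e', v.closure.alexanderMatrix.adjugate e e' =
      c * T ((v.closure.next e').2.val : ℤ)) :
    ∃ ε : ℤˣ, substSq c * ∑ i ∈ Finset.range n, T (2 * i) =
      ((ε : ℤ) : ℤ[T;T⁻¹]) * (1 - (burau v.toBraid).val).det := by
  let e₀ : Fin (v.length + 1) × Fin n := (0, ⟨0, hn⟩)
  let A : Matrix (Fin (v.length + 1) × Fin n) (Fin (v.length + 1) × Fin n) ℤ[T;T⁻¹] :=
    v.closure.alexanderMatrix
  let nx : Equiv.Perm (Fin (v.length + 1) × Fin n) := v.closure.next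
  let a : Fin (v.length + 1) × Fin n → ℤ[T;T⁻¹] := fun e => if (nx e).1 = 0 then 1 else 0
  let D : Matrix (Fin n) (Fin n) ℤ[T;T⁻¹] := of fun _ q => if q.val = 0 then 1 else 0
  have hA0 : A.det = 0 := by
    refine exists_mulVec_eq_zero_iff.mp ⟨1, ?_, v.alexanderMatrix_closure_mulVec_one⟩
    intro h
    exact one_ne_zero (congrFun h e₀)
  have h1 : (A + vecMulVec a (Pi.single e₀ 1)).det =
      c * ∑ i ∈ Finset.range n, T (i : ℤ) := by
    rw [det_add_vecMulVec_single, hA0, zero_add]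
    have h2 : ∀ j, A.adjugate e₀ j = c * T ((nx j).2.val : ℤ) := hc e₀
    simp only [h2, a]
    rw [Equiv.sum_comp nx (fun j => c * T (j.2.val : ℤ) * if j.1 = 0 then 1 else 0),
      Fintype.sum_prod_type, Finset.mul_sum, ← Fin.sum_univ_eq_sum_range (fun i => c * T (i : ℤ))]
    simp
  have h2 : A + vecMulVec a (Pi.single e₀ 1) =
      (cyclicBlock v.length (stepMatrix v) + of fun a b : Fin (v.length + 1) × Fin n =>
        if a.1 = 0 ∧ b.1 = 0 then D a.2 b.2 else 0).submatrix nx id := by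
    have h3 : A = (cyclicBlock v.length (stepMatrix v)).submatrix nx id :=
      v.alexanderMatrix_closure
    rw [h3]
    ext1 x y
    rw [Matrix.add_apply, submatrix_apply, submatrix_apply, Matrix.add_apply]
    congr 1
    simp only [vecMulVec_apply, a, D, submatrix_apply, of_apply, id, Pi.single_apply, e₀,
      Prod.ext_iff, Fin.ext_iff]
    by_cases hx : (nx x).1.val = 0 <;> by_cases hy : y.1.val = 0 <;> simp [hx, hy]
  have h3 : revProd (stepMatrix v) (v.length + 1) = revProd (stepMatrix v) v.length := by
    rw [revProd, stepMatrix, dif_neg (lt_irrefl _), Matrix.one_mul]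
  rw [h2, det_permute, det_cyclicBlock_add, h3] at h1
  have h4 := congrArg substSq h1
  rw [map_mul, map_mul, map_sum, RingHom.map_det] at h4
  simp only [substSq_T] at h4
  let P := (revProd (stepMatrix v) v.length).map substSq
  have h5 : substSq.mapMatrix (1 - revProd (stepMatrix v) v.length + D) =
      1 - P + of fun _ q : Fin n => if q.val = 0 then 1 else 0 := by
    rw [map_add, map_sub, map_one]
    congr 1
    ext1 x y
    simp only [RingHom.mapMatrix_apply, map_apply, D, of_apply]
    split_ifs <;> simp
  have hP1 : P *ᵥ 1 = 1 := by
    ext1 i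
    have h6 := substSq.map_mulVec (revProd (stepMatrix v) v.length) 1 i
    rw [v.revProd_mulVec_one v.length] at h6
    have h7 : substSq ∘ (1 : Fin n → ℤ[T;T⁻¹]) = 1 := by ext1; simp
    rw [h7] at h6
    simpa [P] using h6.symm
  have hP2 := v.diffMatrix_mul_revProd v.length le_rfl
  rw [List.take_length] at hP2
  rw [h5, det_one_sub_add_eq hn hP1 hP2, ← transpose_one, ← transpose_sub, det_transpose] at h4
  refine ⟨Equiv.Perm.sign nx, ?_⟩
  rw [← h4]
  congr 1
  simp

theorem exists_isAlexanderPolynomial {m : ℕ} (v : BraidWord (2 * m + 1)) :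
    ∃ c, v.closure.IsAlexanderPolynomial c ∧
      substSq c * quantumInt (2 * m + 1) = (1 - (burau v.toBraid).val).det ∧
      (v.closure.IsKnot → IsUnit (evalOne c)) := by
  let e₀ : v.closure.Edge := ((0 : Fin (v.length + 1)), (0 : Fin (2 * m + 1)))
  obtain ⟨c, hc⟩ := v.adjugate_alexanderMatrix_closure e₀
  obtain ⟨ε, hε⟩ := v.substSq_mul_sum (Nat.succ_pos _) hc
  -- This unit absorbs the sign and centres the geometric sum in s² into the symmetric [2m+1].
  have hu : IsUnit (((ε : ℤ) : ℤ[T;T⁻¹]) * T m) :=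
    (ε.isUnit.map (Int.castRingHom ℤ[T;T⁻¹])).mul (isUnit_T _)
  have hεε : (((ε : ℤ) : ℤ[T;T⁻¹]) * ((ε : ℤ) : ℤ[T;T⁻¹])) = 1 := by
    rw [← Int.cast_mul, ← Units.val_mul, Int.units_mul_self]
    simp
  refine ⟨c * (((ε : ℤ) : ℤ[T;T⁻¹]) * T m), ?_, ?_, ?_⟩
  · intro d
    rw [hu.dvd_mul_right]
    constructor
    · intro h e e'
      rw [hc]
      exact h.mul_right _
    · intro h
      have := h e₀ e₀
      rw [hc] at this
      exact (isUnit_T _).dvd_mul_right.mp this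
  · have h1 : quantumInt (2 * m + 1) = T (-(2 * m)) * ∑ i ∈ Finset.range (2 * m + 1), T (2 * i) := by
      rw [quantumInt, Finset.mul_sum]
      refine Finset.sum_congr rfl fun i _ => ?_
      rw [← T_add]
      congr 1
      push_cast
      ring
    have h2 : (T (2 * m) * T (-(2 * m)) : ℤ[T;T⁻¹]) = 1 := by rw [← T_add]; simp
    rw [h1, map_mul, map_mul, map_intCast, substSq_T]
    linear_combination ((ε : ℤ) : ℤ[T;T⁻¹]) * (T (2 * m) * T (-(2 * m)) : ℤ[T;T⁻¹]) * hε +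
      (1 - (burau v.toBraid).val).det * (T (2 * m) * T (-(2 * m)) : ℤ[T;T⁻¹]) * hεε +
      (1 - (burau v.toBraid).val).det * h2
  · intro hK
    have h1 := v.closure.isUnit_evalOne_adjugate hK e₀
    rw [hc, map_mul, evalOne_T, mul_one] at h1
    rw [map_mul]
    exact h1.mul (hu.map evalOne)

end BraidWord

/-! ### Symmetric Laurent polynomials and polynomials in s ± 1/s -/

/-- A palindromic polynomial of degree at most `2 * m` is `x ^ m * q (x + x⁻¹)`. -/
theorem Polynomial.exists_aeval_eq_of_palindromic {S : Type*} [CommRing S] {p : S[X]}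
    {m : ℕ} (hd : p.natDegree ≤ 2 * m) (hp : ∀ j < m, p.coeff (2 * m - j) = p.coeff j) :
    ∃ q : S[X], ∀ (A : Type) [CommRing A] [Algebra S A] (x y : A), x * y = 1 →
      aeval x p = x ^ m * aeval (x + y) q := by
  -- Coefficients j and 2m − j pair up to x^m(x^(m−j) + y^(m−j)), and `dickson 1 1` writes such
  -- power sums as polynomials in x + y.
  refine ⟨∑ j ∈ Finset.range m, Polynomial.C (p.coeff j) * dickson 1 1 (m - j) +
    Polynomial.C (p.coeff m), fun A _ _ x y hxy => ?_⟩
  have hdick : ∀ k, aeval (x + y) (dickson 1 (1 : S) k) = x ^ k + y ^ k := by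
    intro k
    rw [← dickson_one_one_eval_add_inv x y hxy, aeval_def, ← eval_map, map_dickson, map_one]
  rw [aeval_eq_sum_range' (n := 2 * m + 1) (by omega), show 2 * m + 1 = m + (m + 1) by ring,
    Finset.sum_range_add, Finset.sum_range_succ', 
    ← Finset.sum_range_reflect (fun j => p.coeff (m + (j + 1)) • x ^ (m + (j + 1))) m, map_add, map_sum,
    aeval_C, mul_add, Finset.mul_sum, ← add_assoc, ← Finset.sum_add_distrib]
  congr 1
  · refine Finset.sum_congr rfl fun j hj => ?_
    have hj := Finset.mem_range.mp hj
    rw [map_mul, aeval_C, hdick, show m + (m - 1 - j + 1) = 2 * m - j by omega, hp j hj,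
      Algebra.smul_def, Algebra.smul_def]
    have h1 : x ^ m * y ^ (m - j) = x ^ j := by
      conv_lhs => rw [show m = j + (m - j) by omega, pow_add]
      rw [Nat.add_sub_cancel_left, mul_assoc, ← mul_pow, hxy, one_pow, mul_one]
    have h2 : x ^ (2 * m - j) = x ^ m * x ^ (m - j) := by
      rw [← pow_add]; congr 1; omega
    rw [h2]
    linear_combination -(algebraMap S A (p.coeff j)) * h1
  · rw [Algebra.smul_def, add_zero, mul_comm]

namespace LaurentPolynomial

/-- The substitution `p ↦ p (s + s⁻¹)`. -/
noncomputable def symmEval : ℤ[X] →ₐ[ℤ] ℤ[T;T⁻¹] := aeval (T 1 + T (-1))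

theorem aeval_add_smul_injective {ε : ℤ} (hε : ε = 1 ∨ ε = -1) :
    Function.Injective (aeval (T 1 + ε • T (-1) : ℤ[T;T⁻¹]) : ℤ[X] → ℤ[T;T⁻¹]) := by
  rw [← AlgHom.coe_toRingHom, injective_iff_map_eq_zero]
  intro p hp
  rw [AlgHom.coe_toRingHom] at hp
  rw [← Polynomial.map_eq_zero_iff (RingHom.injective_int (Int.castRingHom ℚ))]
  -- Specializing s to k + 2 gives infinitely many roots; starting at 2 keeps the values distinct,
  -- since (k+2)(l+2) > 1.
  let x : ℕ → ℚ := fun k => (k + 2) + ε * (k + 2 : ℚ)⁻¹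
  refine eq_zero_of_infinite_isRoot _ (Set.Infinite.mono (s := Set.range x) ?_ ?_)
  · rintro _ ⟨k, rfl⟩
    have hk : (k + 2 : ℚ) ≠ 0 := by positivity
    let f : ℤ[T;T⁻¹] →+* ℚ := eval₂ (Int.castRingHom ℚ) (Units.mk0 (k + 2 : ℚ) hk)
    have h1 := congrArg f hp
    rw [map_zero, aeval_def, hom_eval₂] at h1
    have h2 : f (T 1 + ε • T (-1)) = x k := by
      rw [map_add, map_zsmul, eval₂_T, eval₂_T]
      simp [x]
    rw [h2] at h1
    rw [Set.mem_ofPred_eq, IsRoot.def, eval_map, ← h1]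
    congr 1
    exact RingHom.ext_int _ _
  · refine Set.infinite_range_of_injective fun k l hkl => ?_
    have h1 : (k + 2 : ℚ) ≠ 0 := by positivity
    have h2 : (l + 2 : ℚ) ≠ 0 := by positivity
    simp only [x] at hkl
    field_simp at hkl
    have h3 : ((k : ℚ) - l) * ((k + 2) * (l + 2) - ε) = 0 := by linear_combination hkl
    rcases mul_eq_zero.mp h3 with h | h
    · exact_mod_cast sub_eq_zero.mp h
    · exfalso
      have h4 : (ε : ℚ) ≤ 1 := by
        rcases hε with rfl | rfl <;> norm_num
      nlinarith [(Nat.cast_nonneg k : (0 : ℚ) ≤ k), (Nat.cast_nonneg l : (0 : ℚ) ≤ l)]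

theorem symmEval_injective : Function.Injective symmEval := by
  have := aeval_add_smul_injective (ε := 1) (by simp)
  rwa [one_smul] at this

theorem aeval_sub_injective :
    Function.Injective (aeval (T 1 - T (-1) : ℤ[T;T⁻¹]) : ℤ[X] → ℤ[T;T⁻¹]) := by
  have := aeval_add_smul_injective (ε := -1) (by simp)
  rwa [neg_one_smul, ← sub_eq_add_neg] at this

theorem invert_symmEval (p : ℤ[X]) : invert (symmEval p) = symmEval p := by
  rw [symmEval, ← AlgEquiv.coe_toAlgHom, ← aeval_algHom_apply]
  congr 1
  simp [add_comm]

theorem evalOne_symmEval (p : ℤ[X]) : evalOne (symmEval p) = p.eval 2 := by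
  rw [symmEval, aeval_def, hom_eval₂, map_add, evalOne_T, evalOne_T]
  rw [eval, show evalOne.comp (algebraMap ℤ ℤ[T;T⁻¹]) = RingHom.id ℤ from RingHom.ext_int _ _]
  norm_num

theorem evalOne_invert (x : ℤ[T;T⁻¹]) : evalOne (invert x) = evalOne x := by
  induction x using LaurentPolynomial.induction_on' with
  | add p q hp hq => rw [map_add, map_add, map_add, hp, hq]
  | C_mul_T n a => simp

theorem coeff_mul_T (x : ℤ[T;T⁻¹]) (n k : ℤ) : (x * T n).coeff k = x.coeff (k - n) := by
  induction x using LaurentPolynomial.induction_on' with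
  | add p q hp hq => rw [add_mul, AddMonoidAlgebra.coeff_add, AddMonoidAlgebra.coeff_add,
      Finsupp.add_apply, Finsupp.add_apply, hp, hq]
  | C_mul_T m a =>
    rw [mul_assoc, ← T_add, ← single_eq_C_mul_T, ← single_eq_C_mul_T,
      AddMonoidAlgebra.coeff_single, AddMonoidAlgebra.coeff_single, Finsupp.single_apply,
      Finsupp.single_apply]
    exact if_congr (by constructor <;> intro h <;> linarith) rfl rfl

theorem exists_symmEval_eq {x : ℤ[T;T⁻¹]} (hx : invert x = x) : ∃ p, symmEval p = x := by
  obtain ⟨n, f, hf⟩ := exists_T_pow x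
  have hsymm : ∀ k, x.coeff (-k) = x.coeff k := fun k => by rw [← invert_apply, hx]
  have hcoeff : ∀ j : ℕ, f.coeff j = x.coeff (j - n) := by
    intro j
    rw [← coeff_mul_T, ← hf, coeff_toLaurent]
    exact (Finsupp.mapDomain_apply Nat.castEmbedding.injective _ j).symm
  have hneg : ∀ k : ℤ, k < 0 → x.coeff (k - n) = 0 := by
    intro k hk
    rw [← coeff_mul_T, ← hf, coeff_toLaurent]
    refine Finsupp.mapDomain_of_notMem_range _ _ ?_
    rintro ⟨j, rfl⟩
    exact absurd hk (not_lt.mpr (Int.natCast_nonneg j))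
  obtain ⟨q, hq⟩ := exists_aeval_eq_of_palindromic (p := f) (m := n)
    (by
      rw [natDegree_le_iff_coeff_eq_zero]
      intro j hj
      rw [hcoeff, ← hsymm]
      have := hneg (2 * n - j) (by omega)
      rwa [show (2 * n - j - n : ℤ) = -(j - n) by ring] at this)
    (by
      intro j hj
      rw [hcoeff, hcoeff, ← hsymm]
      congr 1
      omega)
  refine ⟨q, ?_⟩
  have h1 := hq ℤ[T;T⁻¹] (T 1) (T (-1)) (by rw [← T_add]; simp)
  have h2 : aeval (T 1 : ℤ[T;T⁻¹]) f = toLaurent f := by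
    rw [← toLaurentAlg_apply, ← toLaurent_X, ← toLaurentAlg_apply, aeval_algHom_apply, aeval_X_left]
    rfl
  rw [h2, hf, T_pow, mul_comm, mul_one] at h1
  exact ((isUnit_T (n : ℤ)).mul_left_cancel h1).symm

theorem exists_eq_mul_T_of_isUnit {u : ℤ[T;T⁻¹]} (hu : IsUnit u) :
    ∃ (e : ℤˣ) (j : ℤ), u = ((e : ℤ) : ℤ[T;T⁻¹]) * T j := by
  obtain ⟨w, hw⟩ := hu.exists_right_inv
  obtain ⟨a, f, hf⟩ := exists_T_pow u
  obtain ⟨b, g, hg⟩ := exists_T_pow w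
  have h1 : f * g = X ^ (a + b) := by
    apply toLaurent_injective
    rw [map_mul, hf, hg, toLaurent_X_pow]
    push_cast
    rw [T_add]
    linear_combination (T a * T b : ℤ[T;T⁻¹]) * hw
  obtain ⟨i, -, hi⟩ := (dvd_prime_pow prime_X _).mp (Dvd.intro _ h1)
  obtain ⟨v, hv⟩ := hi.symm
  obtain ⟨r, hr, hrv⟩ := Polynomial.isUnit_iff.mp v.isUnit
  obtain ⟨e, rfl⟩ := hr
  refine ⟨e, i - a, ?_⟩
  apply (isUnit_T (a : ℤ)).mul_right_cancel
  rw [← hf, ← hv, ← hrv, map_mul, toLaurent_X_pow, toLaurent_C, mul_assoc, ← T_add,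
    sub_add_cancel, mul_comm]
  congr 1

end LaurentPolynomial

namespace LaurentPolynomial

open LinkDiagram

theorem substSq_injective : Function.Injective substSq := by
  intro x y h
  have : Function.Injective (AddMonoidAlgebra.mapDomain (R := ℤ) (AddMonoidHom.mulLeft (2 : ℤ))) :=
    AddMonoidAlgebra.mapDomain_injective fun a b hab => by simpa using hab
  exact this h

theorem ringHom_ext_T {S : Type*} [CommRing S] {f g : ℤ[T;T⁻¹] →+* S}
    (h : ∀ k, f (T k) = g (T k)) : f = g := by
  refine RingHom.ext fun x => ?_
  induction x using LaurentPolynomial.induction_on' with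
  | add p q hp hq => rw [map_add, map_add, hp, hq]
  | C_mul_T n a =>
    rw [map_mul, map_mul, h]
    congr 1
    exact DFunLike.congr_fun (RingHom.ext_int (f.comp LaurentPolynomial.C) (g.comp LaurentPolynomial.C)) a

theorem invert_substSq (x : ℤ[T;T⁻¹]) : invert (substSq x) = substSq (invert x) := by
  have : (invert : ℤ[T;T⁻¹] ≃ₐ[ℤ] ℤ[T;T⁻¹]).toRingHom.comp substSq =
      substSq.comp (invert : ℤ[T;T⁻¹] ≃ₐ[ℤ] ℤ[T;T⁻¹]).toRingHom := by
    apply ringHom_ext_T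
    intro k
    change invert (substSq (T k)) = substSq (invert (T k))
    rw [invert_T, substSq_T, substSq_T, invert_T, mul_neg]
  exact DFunLike.congr_fun this x

theorem evalOne_substSq (x : ℤ[T;T⁻¹]) : evalOne (substSq x) = evalOne x := by
  have : evalOne.comp substSq = evalOne := by
    apply ringHom_ext_T
    intro k
    rw [RingHom.comp_apply, substSq_T, evalOne_T, evalOne_T]
  exact DFunLike.congr_fun this x

theorem substSq_symmEval (p : ℤ[X]) :
    substSq (symmEval p) = symmEval (p.comp (X ^ 2 - 2)) := by
  rw [symmEval, aeval_comp, aeval_def, hom_eval₂, aeval_def]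
  congr 1
  · exact RingHom.ext_int _ _
  rw [map_add, substSq_T, substSq_T, map_sub, map_pow, aeval_X, map_ofNat]
  have h1 : (T 1 * T (-1) : ℤ[T;T⁻¹]) = 1 := by rw [← T_add]; simp
  have h2 : (T (2 * 1) : ℤ[T;T⁻¹]) = T 1 * T 1 := by rw [← T_add]; rfl
  have h3 : (T (2 * -1) : ℤ[T;T⁻¹]) = T (-1) * T (-1) := by rw [← T_add]; rfl
  rw [h2, h3]
  linear_combination -2 * h1

theorem exists_symmEval_comp_eq {c : ℤ[T;T⁻¹]} (h : invert (substSq c) = substSq c) :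
    ∃ H : ℤ[X], substSq c = symmEval (H.comp (X ^ 2 - 2)) := by
  rw [invert_substSq] at h
  obtain ⟨H, rfl⟩ := exists_symmEval_eq (substSq_injective h)
  exact ⟨H, substSq_symmEval H⟩

theorem comp_sq_comp_neg (H : ℤ[X]) : (H.comp (X ^ 2 - 2)).comp (-X) = H.comp (X ^ 2 - 2) := by
  rw [comp_assoc]
  simp

/-- The identity (s − 1/s)² + 2 = (s + 1/s)² − 2 is what relates the Conway variable z to y. -/
theorem aeval_sub_eq_symmEval (H : ℤ[X]) :
    aeval (T 1 - T (-1) : ℤ[T;T⁻¹]) (H.comp (X ^ 2 + 2)) = symmEval (H.comp (X ^ 2 - 2)) := by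
  rw [symmEval, aeval_comp, aeval_comp]
  congr 2
  rw [map_sub, map_add, map_pow, map_pow, aeval_X, aeval_X, map_ofNat]
  have h1 : (T 1 * T (-1) : ℤ[T;T⁻¹]) = 1 := by rw [← T_add]; simp
  rw [map_ofNat]
  linear_combination -4 * h1

/-- A square which is an even symmetric Laurent polynomial splits. -/
theorem exists_symmEval_mul_of_sq {x : ℤ[T;T⁻¹]} {p : ℤ[X]} (hx : x ^ 2 = symmEval p)
    (hp : p.comp (-X) = p) (h1 : evalOne x ≠ 0) :
    ∃ (F : ℤ[X]) (ε : ℤˣ), p = ((ε : ℤ) : ℤ[X]) * (F * F.comp (-X)) := by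
  -- The square root is symmetric or antisymmetric, and an antisymmetric one vanishes at s = 1.
  have h2 : invert x = x := by
    have h3 : (invert x) ^ 2 = x ^ 2 := by rw [← map_pow, hx, invert_symmEval]
    rcases sq_eq_sq_iff_eq_or_eq_neg.mp h3 with h | h
    · exact h
    · exfalso
      have := evalOne_invert x
      rw [h, map_neg] at this
      omega
  obtain ⟨F, rfl⟩ := exists_symmEval_eq h2
  rw [← map_pow] at hx
  have h3 := symmEval_injective hx
  -- Since F² is even, F is even or odd, which accounts for the sign in the splitting.
  have h4 : F.comp (-X) ^ 2 = F ^ 2 := by rw [← pow_comp, h3, hp]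
  rcases sq_eq_sq_iff_eq_or_eq_neg.mp h4 with h | h
  · exact ⟨F, 1, by rw [h, ← h3]; simp [sq]⟩
  · exact ⟨F, -1, by rw [h, ← h3]; simp [sq]⟩

end LaurentPolynomial

/-! ### The Conway polynomial and its reduction modulo 4 -/

namespace LinkDiagram

/-- The substitution s ↦ −1/s fixes s − 1/s, so it fixes the unit ±s^j relating the two sides. This
forces j = 0, and the value at z = 0 settles the sign. -/
theorem eq_of_associated_aeval_sub {C C' : ℤ[X]} (hC : C.eval 0 = 1) (hC' : C'.eval 0 = 1)
    (h : Associated (aeval (T 1 - T (-1) : ℤ[T;T⁻¹]) C) (aeval (T 1 - T (-1) : ℤ[T;T⁻¹]) C')) :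
    C = C' := by
  obtain ⟨u, hu⟩ := h
  obtain ⟨e, j, hej⟩ := exists_eq_mul_T_of_isUnit u.isUnit
  rw [hej] at hu
  have h1m : (T 1 * T (-1) : ℤ[T;T⁻¹]) = 1 := by rw [← T_add]; simp
  let w : ℤ[T;T⁻¹]ˣ := ⟨-T (-1), -T 1, by linear_combination h1m, by linear_combination h1m⟩
  let f : ℤ[T;T⁻¹] →+* ℤ[T;T⁻¹] := eval₂ (Int.castRingHom _) w
  have hfT : ∀ k, f (T k) = (w ^ k).val := fun k => eval₂_T _ _ _
  have hf : ∀ p : ℤ[X], f (aeval (T 1 - T (-1) : ℤ[T;T⁻¹]) p) =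
      aeval (T 1 - T (-1) : ℤ[T;T⁻¹]) p := by
    intro p
    rw [aeval_def, hom_eval₂]
    congr 1
    · exact RingHom.ext_int _ _
    · rw [map_sub, hfT, hfT, zpow_one, zpow_neg, zpow_one]
      change -T (-1) - -T 1 = _
      ring
  have hne : aeval (T 1 - T (-1) : ℤ[T;T⁻¹]) C ≠ 0 := by
    intro h0
    have : C = 0 := aeval_sub_injective (h0.trans (map_zero _).symm)
    simp [this] at hC
  have h2 := congrArg f hu
  rw [map_mul, map_mul, hf, hf, map_intCast, hfT, ← hu] at h2
  have h3 := mul_left_cancel₀ hne h2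
  have he : ((e : ℤ) : ℤ[T;T⁻¹]) ≠ 0 := by
    rcases Int.units_eq_one_or e with rfl | rfl <;> simp
  have h4 := mul_left_cancel₀ he h3
  -- Squaring removes the sign (−1)^j from (−1/s)^j.
  have h5 : ((w ^ j) ^ 2).val = (T (-2 * j) : ℤ[T;T⁻¹]) := by
    let t : ℤ[T;T⁻¹]ˣ := ⟨T (-2), T 2, by rw [← T_add]; rfl, by rw [← T_add]; rfl⟩
    have hw : w ^ 2 = t := by
      ext1
      change (-T (-1)) ^ 2 = T (-2)
      rw [neg_sq, T_pow]
      rfl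
    have ht : ∀ k : ℤ, (t ^ k).val = T (-2 * k) := by
      intro k
      obtain ⟨k, rfl | rfl⟩ := k.eq_nat_or_neg
      · rw [zpow_natCast, Units.val_pow_eq_pow_val]
        change T (-2) ^ k = _
        rw [T_pow, mul_comm]
      · rw [zpow_neg, ← inv_zpow, zpow_natCast, Units.val_pow_eq_pow_val]
        change T 2 ^ k = _
        rw [T_pow]
        congr 1
        ring
    rw [← ht, ← hw, ← zpow_natCast, ← zpow_mul, ← zpow_natCast, ← zpow_mul, mul_comm]
  have h6 : (T (2 * j) : ℤ[T;T⁻¹]) = T (-2 * j) := by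
    rw [← h5, Units.val_pow_eq_pow_val, h4, T_pow]
    rfl
  have h7 : j = 0 := by
    have := congrArg (fun x : ℤ[T;T⁻¹] => x.coeff (2 * j)) h6
    simp only [T_apply, if_true] at this
    split_ifs at this with h
    · omega
    · exact absurd this one_ne_zero
  subst h7
  have h8 : C * ((e : ℤ) : ℤ[X]) = C' := by
    apply aeval_sub_injective
    rw [← hu, map_mul, map_intCast, T_zero, mul_one]
  have h9 := congrArg (eval 0) h8
  rw [eval_mul, hC, hC', eval_intCast] at h9
  have h10 : (e : ℤ) = 1 := by simpa using h9
  rw [← h8, h10]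
  simp

/-- C is ±H(z² + 2), with the sign making Δ(1) = 1. Modulo 4 it coincides with ±H(X² − 2), so a
splitting found in y = s + 1/s serves for z. -/
theorem existsUnique_isConwayPolynomial_and_splits (D : LinkDiagram) {c : ℤ[T;T⁻¹]}
    (hc : D.IsAlexanderPolynomial c) (hu : IsUnit (evalOne c)) {H : ℤ[X]}
    (hH : substSq c = symmEval (H.comp (X ^ 2 - 2))) {F r : ℤ[X]} {ε : ℤˣ}
    (hF : H.comp (X ^ 2 - 2) = ((ε : ℤ) : ℤ[X]) * (F * F.comp (-X)) + 4 * r) :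
    (∃! C : ℤ[X], D.IsConwayPolynomial C) ∧ ∀ C : ℤ[X], D.IsConwayPolynomial C →
      ∃ f : (ZMod 4)[X], C.map (Int.castRingHom (ZMod 4)) = f * f.comp (-X) := by
  have h2 : H.eval 2 = evalOne c := by
    rw [← evalOne_substSq, hH, evalOne_symmEval, eval_comp]
    norm_num
  obtain ⟨δ, hδ⟩ := hu
  let C : ℤ[X] := ((δ : ℤ) : ℤ[X]) * H.comp (X ^ 2 + 2)
  have hδδ : (δ : ℤ) * (δ : ℤ) = 1 := by rw [← Units.val_mul, Int.units_mul_self]; rfl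
  have hC0 : C.eval 0 = 1 := by
    simp only [C, eval_mul, eval_comp, eval_intCast, eval_add, eval_pow, eval_X]
    norm_num
    rw [h2, ← hδ]
    exact hδδ
  have hCz : aeval (T 1 - T (-1) : ℤ[T;T⁻¹]) C = substSq c * ((δ : ℤ) : ℤ[T;T⁻¹]) := by
    rw [map_mul, aeval_sub_eq_symmEval, hH, map_intCast, mul_comm]
  have hδu : IsUnit ((δ : ℤ) : ℤ[T;T⁻¹]) := δ.isUnit.map (Int.castRingHom ℤ[T;T⁻¹])
  have hC : D.IsConwayPolynomial C := by
    refine ⟨hC0, c, hc, ?_⟩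
    rw [hCz]
    exact (associated_mul_unit_right _ _ hδu).symm
  have huniq : ∀ C', D.IsConwayPolynomial C' → C' = C := by
    rintro C' ⟨hC'0, Δ, hΔ, hass⟩
    apply eq_of_associated_aeval_sub hC'0 hC0
    have h3 : Associated Δ c := by
      apply associated_of_dvd_dvd
      · exact (hc Δ).mpr ((hΔ Δ).mp dvd_rfl)
      · exact (hΔ c).mpr ((hc c).mp dvd_rfl)
    refine hass.trans ((h3.map substSq).trans ?_)
    rw [hCz]
    exact associated_mul_unit_right _ _ hδu
  refine ⟨⟨C, hC, huniq⟩, ?_⟩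
  intro C' hC'
  rw [huniq C' hC']
  let π := Int.castRingHom (ZMod 4)
  have h4 : (4 : (ZMod 4)[X]) = 0 := by
    rw [← map_ofNat (Polynomial.C : ZMod 4 →+* (ZMod 4)[X]) 4]
    have : (4 : ZMod 4) = 0 := by decide
    rw [show (OfNat.ofNat 4 : ZMod 4) = 0 from this, map_zero]
  have h5 : (X ^ 2 + 2 : (ZMod 4)[X]) = X ^ 2 - 2 := by linear_combination h4
  have h6 : C.map π = (((δ * ε : ℤˣ) : ℤ) : (ZMod 4)[X]) * (F.map π * (F.map π).comp (-X)) := by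
    have h7 := congrArg (Polynomial.map π) hF
    simp only [Polynomial.map_add, Polynomial.map_mul, Polynomial.map_comp, Polynomial.map_sub,
      Polynomial.map_pow, Polynomial.map_X, Polynomial.map_ofNat, Polynomial.map_neg,
      Polynomial.map_intCast, h4, zero_mul, add_zero] at h7
    simp only [C, Polynomial.map_add, Polynomial.map_mul, Polynomial.map_comp,
      Polynomial.map_pow, Polynomial.map_X, Polynomial.map_ofNat, Polynomial.map_intCast, h5, h7]
    push_cast
    ring
  -- At 0 the identity reads 1 = ±a², and −1 is not a square modulo 4.
  have h7 : ((δ * ε : ℤˣ) : ℤ) = 1 := by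
    have h8 := congrArg (eval 0) h6
    rw [eval_mul, eval_mul, eval_comp, eval_neg, eval_X, neg_zero, eval_intCast] at h8
    rw [eval_zero_map, hC0, map_one] at h8
    generalize (F.map π).eval 0 = a at h8
    rcases Int.units_eq_one_or (δ * ε) with h | h
    · rw [h]; rfl
    · exfalso
      rw [h] at h8
      revert h8
      push_cast
      revert a
      decide
  refine ⟨F.map π, ?_⟩
  rw [h6, h7]
  simp

end LinkDiagram

/-! ### Characteristic polynomials and determinants -/

namespace Matrix

/-- J is needed only up to fractions: it will be `form`, whose determinant [n] need not be a unit.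
-/
theorem charpoly_eq_of_mul_eq {R ι : Type*} [CommRing R] [IsDomain R] [Fintype ι] [DecidableEq ι]
    {A B J : Matrix ι ι R} (hJ : J.det ≠ 0) (h : J * A = B * J) : A.charpoly = B.charpoly := by
  have h1 : (Polynomial.C : R →+* R[X]).mapMatrix J * A.charmatrix =
      B.charmatrix * (Polynomial.C : R →+* R[X]).mapMatrix J := by
    rw [charmatrix, charmatrix, mul_sub, sub_mul, ← map_mul, ← map_mul, h,
      (scalar_commute (X : R[X]) (fun r => Commute.all _ r) _).eq]
  have h2 := congrArg det h1
  rw [det_mul, det_mul, mul_comm, ← RingHom.map_det] at h2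
  exact mul_right_cancel₀ (by rwa [Ne, Polynomial.C_eq_zero]) h2

theorem det_add_eq_charpoly {R : Type*} [CommRing R] {k m : ℕ} (hk : k = 2 * m)
    (M : Matrix (Fin k) (Fin k) R) : (1 + M).det = M.charpoly.eval (-1) := by
  have h : ((-1 : R) ^ k) = 1 := by rw [hk, pow_mul, neg_one_sq, one_pow]
  rw [eval_charpoly, map_neg, map_one, ← neg_add', det_neg, Fintype.card_fin, h, one_mul]

theorem det_sub_eq_charpoly {R : Type*} [CommRing R] {k : ℕ}
    (M : Matrix (Fin k) (Fin k) R) : (1 - M).det = M.charpoly.eval 1 := by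
  rw [eval_charpoly, map_one]

/-- If the characteristic polynomial of `M` is palindromic, then `det (1 + M ^ 2)` is a square. -/
theorem det_one_add_sq_of_palindromic {R : Type} [CommRing R] [IsDomain R] {k m : ℕ}
    (M : Matrix (Fin k) (Fin k) R) {q : R[X]}
    (hq : ∀ (A : Type) [CommRing A] [Algebra R A] (x y : A), x * y = 1 →
      aeval x M.charpoly = x ^ m * aeval (x + y) q) : (1 + M ^ 2).det = (q.eval 0) ^ 2 := by
  let S := AlgebraicClosure (FractionRing R)
  -- With i² = −1, 1 + M² factors as (i − M)(−i − M). Both x = ±i have x + 1/x = 0, so the factors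
  -- have determinants (±i)^m q(0).
  obtain ⟨i, hi⟩ := IsAlgClosed.exists_pow_nat_eq (-1 : S) (n := 2) (by norm_num)
  have hinj : Function.Injective (algebraMap R S) := by
    rw [IsScalarTower.algebraMap_eq R (FractionRing R) S]
    exact (algebraMap (FractionRing R) S).injective.comp (IsFractionRing.injective R _)
  let N := (algebraMap R S).mapMatrix M
  have key : ∀ x y : S, x * y = 1 → x + y = 0 →
      (scalar (Fin k) x - N).det = x ^ m * algebraMap R S (q.eval 0) := by
    intro x y hxy h0
    have h1 := hq S x y hxy
    rw [h0, aeval_def, ← eval_map, ← charpoly_map, eval_charpoly] at h1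
    change (scalar (Fin k) x - M.map (algebraMap R S)).det = _
    rw [h1, aeval_def, eval₂_at_zero, ← coeff_zero_eq_eval_zero]
  have h1 := key i (-i) (by linear_combination -hi) (by ring)
  have h2 := key (-i) i (by linear_combination -hi) (by ring)
  have h3 : (scalar (Fin k) i - N) * (scalar (Fin k) (-i) - N) = 1 + N ^ 2 := by
    have h4 : scalar (Fin k) i * N = N * scalar (Fin k) i :=
      (scalar_commute i (fun r => Commute.all _ r) N).eq
    have h5 : scalar (Fin k) i * scalar (Fin k) i = -1 := by
      rw [← map_mul, ← sq, hi, map_neg, map_one]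
    rw [map_neg, sub_mul, mul_sub, mul_sub, mul_neg, mul_neg, h4, h5, sq]
    abel
  apply hinj
  rw [RingHom.map_det, map_add, map_one, map_pow]
  change (1 + N ^ 2).det = _
  rw [← h3, det_mul, h1, h2, map_pow]
  have h4 : i ^ m * (-i) ^ m = 1 := by
    rw [← mul_pow, mul_neg, ← sq, hi, neg_neg, one_pow]
  linear_combination (algebraMap R S (q.eval 0)) ^ 2 * h4

theorem mul_pow_conj {G : Type*} [Group G] (a b : G) (l : ℕ) :
    (b * a) ^ l = a⁻¹ * (a * b) ^ l * a := by
  induction l with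
  | zero => simp
  | succ l ih => rw [pow_succ, ih, pow_succ]; group

end Matrix

namespace LaurentPolynomial

instance : IsIntegrallyClosed ℤ[T;T⁻¹] :=
  isIntegrallyClosed_of_isLocalization (R := ℤ[X]) ℤ[T;T⁻¹] (Submonoid.powers X)
    (powers_le_nonZeroDivisors_of_noZeroDivisors X_ne_zero)

end LaurentPolynomial

/-! ### Splitting of [n] and reciprocity for powers of hh* -/

namespace BraidGroup

open Matrix

theorem quantumInt_ne_zero (k : ℕ) : quantumInt (k + 1) ≠ 0 := by
  intro h
  have := congrArg evalOne h
  rw [quantumInt, map_sum, map_zero] at this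
  simp at this
  omega

theorem invert_quantumInt (k : ℕ) : invert (quantumInt k) = quantumInt k := by
  apply mul_left_cancel₀ T_one_sub_T_neg_one_ne_zero
  have h := congrArg (fun x => -invert x) (sub_mul_quantumInt k)
  simp only [map_mul, map_sub, invert_T, neg_neg] at h
  rw [sub_mul_quantumInt]
  linear_combination h

/-- For odd `n` the quantum integer `[n]` splits, up to sign, as `P (y) P (-y)`, `y = s + s⁻¹`. -/
theorem exists_quantumInt_eq (m : ℕ) :
    ∃ P : ℤ[X], quantumInt (2 * m + 1) = (-1) ^ m * symmEval (P * P.comp (-X)) := by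
  let U : ℕ → ℤ[X] := fun k => Chebyshev.S ℤ ((k : ℤ) - 1)
  have hU0 : U 0 = 0 := by simp [U]
  have hU1 : U 1 = 1 := by simp [U]
  have hU : ∀ k, U (k + 2) = X * U (k + 1) - U k := by
    intro k
    have := Chebyshev.S_add_two ℤ ((k : ℤ) - 1)
    simp only [U]
    push_cast
    rw [show (k + 2 - 1 : ℤ) = k - 1 + 2 by ring, this]
    congr 3
    ring
  have hq : ∀ k, symmEval (U k) = quantumInt k := by
    intro k
    induction k using Nat.twoStepInduction with
    | zero => rw [hU0, map_zero]; simp [quantumInt]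
    | one => rw [hU1, map_one]; simp [quantumInt]
    | more k ih1 ih2 =>
      rw [hU, quantumInt_add_two, map_sub, map_mul, ih1, ih2]
      simp [symmEval]
  have hneg : ∀ k, (U k).comp (-X) = -(-1) ^ k * U k := by
    intro k
    induction k using Nat.twoStepInduction with
    | zero => simp [hU0]
    | one => simp [hU1]
    | more k ih1 ih2 =>
      rw [hU, sub_comp, mul_comp, X_comp, ih1, ih2]
      ring
  -- [2m+1] = [m+1]² − [m]² is a product of sum and difference. Consecutive U have opposite
  -- parities, so y ↦ −y exchanges the two factors up to sign.
  refine ⟨U (m + 1) + U m, ?_⟩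
  have h1 : (U (m + 1) + U m).comp (-X) = (-1) ^ m * (U (m + 1) - U m) := by
    rw [add_comp, hneg, hneg]
    ring
  have h2 : ((-1) ^ m * (-1) ^ m : ℤ[T;T⁻¹]) = 1 := by rw [← mul_pow]; simp
  have h3 : quantumInt (2 * m + 1) = quantumInt (m + 1) ^ 2 - quantumInt m ^ 2 := by
    apply mul_left_cancel₀ T_one_sub_T_neg_one_ne_zero
    apply mul_left_cancel₀ T_one_sub_T_neg_one_ne_zero
    have h4 := sub_mul_quantumInt (m + 1)
    have h5 := sub_mul_quantumInt m
    rw [sub_mul_quantumInt]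
    have e1 : (T (2 * m + 1 : ℕ) : ℤ[T;T⁻¹]) = T m * T m * T 1 := by
      rw [← T_add, ← T_add]; congr 1; push_cast; ring
    have e2 : (T (-(2 * m + 1 : ℕ)) : ℤ[T;T⁻¹]) = T (-m) * T (-m) * T (-1) := by
      rw [← T_add, ← T_add]; congr 1; push_cast; ring
    have e3 : (T (m + 1 : ℕ) : ℤ[T;T⁻¹]) = T m * T 1 := by
      rw [← T_add]; congr 1
    have e4 : (T (-(m + 1 : ℕ)) : ℤ[T;T⁻¹]) = T (-m) * T (-1) := by
      rw [← T_add]; congr 1; push_cast; ring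
    have e5 : (T 1 * T (-1) : ℤ[T;T⁻¹]) = 1 := by rw [← T_add]; simp
    rw [e3, e4] at h4
    rw [e1, e2]
    generalize quantumInt (m + 1) = a at h4 ⊢
    generalize quantumInt m = b at h5 ⊢
    linear_combination (-(T m * T m) - T (-m) * T (-m) + 2 * (T m * T (-m))) * e5 -
      ((T 1 - T (-1)) * a + (T m * T 1 - T (-m) * T (-1))) * h4 +
      ((T 1 - T (-1)) * b + (T m - T (-m))) * h5
  rw [h1, h3, map_mul, map_mul, map_pow, map_neg, map_one, map_add, map_sub, hq, hq]
  linear_combination -(quantumInt (m + 1) ^ 2 - quantumInt m ^ 2) * h2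

theorem det_form_ne_zero (k : ℕ) : (form k).det ≠ 0 := by
  rw [det_form]
  exact quantumInt_ne_zero k

variable {n : ℕ}

theorem det_burau_mul_mirror (h : BraidGroup n) : (burau (h * mirror h)).val.det = 1 := by
  have h1 := congrArg det (burau_form h)
  rw [det_mul, det_mul, det_transpose] at h1
  rw [map_mul, Units.val_mul, det_mul]
  apply mul_right_cancel₀ (det_form_ne_zero (n - 1))
  linear_combination h1

/-- The mirror of (hh*)^l is (h*h)^l, which is conjugate to (hh*)^l by h. -/
theorem charpoly_burau_mirror (h : BraidGroup n) (l : ℕ) :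
    (burau (mirror ((h * mirror h) ^ l))).val.charpoly =
      (burau ((h * mirror h) ^ l)).val.charpoly := by
  have h1 : mirror ((h * mirror h) ^ l) = h⁻¹ * (h * mirror h) ^ l * h := by
    rw [map_pow, map_mul, mirror_mirror, mul_pow_conj]
  rw [h1]
  generalize (h * mirror h) ^ l = g
  rw [map_mul, map_mul, map_inv, Units.val_mul, Units.val_mul]
  rw [Matrix.charpoly_mul_comm, ← Matrix.mul_assoc, Units.mul_inv, Matrix.one_mul]

/-- Through the form, ψ(g*) has the characteristic polynomial of ψ(g)⁻¹, which is the reversed one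
because det ψ(g) = 1 and the size is even. Since g* is also conjugate to g, the polynomial equals
its own reverse. -/
theorem charpoly_burau_palindromic {m : ℕ} (h : BraidGroup (2 * m + 1)) (l : ℕ) :
    ∃ q : ℤ[T;T⁻¹][X], ∀ (A : Type) [CommRing A] [Algebra ℤ[T;T⁻¹] A] (x y : A), x * y = 1 →
      aeval x (burau ((h * mirror h) ^ l)).val.charpoly = x ^ m * aeval (x + y) q := by
  set g := (h * mirror h) ^ l with hg
  have hdeg : (burau g).val.charpoly.natDegree = 2 * m := by
    rw [charpoly_natDegree_eq_dim, Fintype.card_fin]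
    rfl
  have hdet : (burau g).val.det = 1 := by
    rw [hg, map_pow, Units.val_pow_eq_pow_val, det_pow, det_burau_mul_mirror, one_pow]
  have hinv : (burau g).val⁻¹ = (burau g)⁻¹.val := (coe_units_inv _).symm
  have h1 : (burau (mirror g)).val.charpoly = ((burau g).val⁻¹ᵀ).charpoly := by
    apply charpoly_eq_of_mul_eq (det_form_ne_zero _)
    have := burau_form g
    calc _ = ((burau g).val * (burau g).val⁻¹)ᵀ * form _ * (burau (mirror g)).val := by
          rw [hinv, Units.mul_inv, transpose_one, Matrix.one_mul]
      _ = (burau g).val⁻¹ᵀ * ((burau g).valᵀ * form _ * (burau (mirror g)).val) := by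
          rw [transpose_mul]; simp only [Matrix.mul_assoc]
      _ = _ := by rw [this]
  rw [charpoly_burau_mirror, ← hg, charpoly_transpose, charpoly_inv _ (Units.isUnit _), hdet,
    Fintype.card_fin, ← reverse_charpoly] at h1
  have h2 : (burau g).val.charpoly = (burau g).val.charpoly.reverse := by
    have h3 : ∀ (S : Type) [CommRing S], ((-1) ^ (2 * m + 1 - 1) : S) = 1 := by
      intro S _
      rw [Nat.add_sub_cancel, pow_mul, neg_one_sq, one_pow]
    rw [h3] at h1
    simpa using h1
  apply exists_aeval_eq_of_palindromic hdeg.le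
  intro j hj
  conv_lhs => rw [h2, coeff_reverse, hdeg, revAt_le (by omega)]
  congr 1
  omega

end BraidGroup

/-! ### Splitting modulo 4 by repeated squaring -/

namespace BraidGroup

open Matrix LinkDiagram

theorem _root_.LaurentPolynomial.ofNat_ne_zero_of_int (k : ℕ) [k.AtLeastTwo] :
    (OfNat.ofNat k : ℤ[T;T⁻¹]) ≠ 0 := by
  intro h
  have := congrArg evalOne h
  rw [map_ofNat, map_zero] at this
  exact OfNat.ofNat_ne_zero k this

theorem exists_sq_eq {m : ℕ} (W : BraidGroup (2 * m + 1)) {x : ℤ[T;T⁻¹]}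
    (hx : x * quantumInt (2 * m + 1) = (1 - (burau (W * mirror W)).val).det) :
    ∃ (G : ℤ[T;T⁻¹]) (ε : ℤˣ), G ^ 2 = ((ε : ℤ) : ℤ[T;T⁻¹]) * x := by
  obtain ⟨ε, j, hdet⟩ := det_burau W
  let K := FractionRing ℤ[T;T⁻¹]
  let φ : ℤ[T;T⁻¹] →+* K := algebraMap ℤ[T;T⁻¹] K
  have hφ : Function.Injective φ := IsFractionRing.injective _ _
  let A := φ.mapMatrix (burau W).val
  let B := φ.mapMatrix (burau (mirror W)).val
  let J := φ.mapMatrix (form (2 * m + 1 - 1))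
  have hJB : Aᵀ * J * B = J := by
    have := congrArg φ.mapMatrix (burau_form W)
    rwa [map_mul, map_mul] at this
  have hJT : Jᵀ = J := by
    have := congrArg φ.mapMatrix (form_transpose (2 * m + 1 - 1))
    exact this
  have hJdet : J.det = φ (quantumInt (2 * m + 1)) := by
    rw [← RingHom.map_det, det_form]
    rfl
  have hJ0 : J.det ≠ 0 := by
    rw [hJdet]
    exact (map_ne_zero_iff φ hφ).mpr (quantumInt_ne_zero _)
  have hJu : IsUnit J.det := hJ0.isUnit
  have hBJ : B * J⁻¹ * Aᵀ = J⁻¹ := by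
    have h1 : Aᵀ * (J * B * J⁻¹) = 1 := by
      rw [← Matrix.mul_assoc, ← Matrix.mul_assoc, hJB, mul_nonsing_inv _ hJu]
    have h2 := mul_eq_one_comm.mp h1
    calc B * J⁻¹ * Aᵀ = (J⁻¹ * J) * (B * J⁻¹ * Aᵀ) := by
          rw [nonsing_inv_mul _ hJu, Matrix.one_mul]
      _ = J⁻¹ * (J * B * J⁻¹ * Aᵀ) := by simp only [Matrix.mul_assoc]
      _ = J⁻¹ := by rw [h2, Matrix.mul_one]
  -- The form gives B J⁻¹ Aᵀ = J⁻¹, so the product is the difference of a matrix and its transpose.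
  have hN : (1 - A * B) * (J⁻¹ * Aᵀ) = J⁻¹ * Aᵀ - A * J⁻¹ := by
    rw [Matrix.sub_mul, Matrix.one_mul, Matrix.mul_assoc A, ← Matrix.mul_assoc B, hBJ]
  have hskew : (J⁻¹ * Aᵀ - A * J⁻¹)ᵀ = -(J⁻¹ * Aᵀ - A * J⁻¹) := by
    rw [transpose_sub, transpose_mul, transpose_mul, transpose_transpose, transpose_nonsing_inv,
      hJT, neg_sub]
  have h2 : (2 : K) ≠ 0 := by
    rw [← map_ofNat φ 2]
    exact (map_ne_zero_iff φ hφ).mpr (ofNat_ne_zero_of_int 2)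
  obtain ⟨κ, hκ⟩ := isSquare_det_of_transpose_eq_neg h2 _ hskew
  have hAdet : A.det = φ (((ε : ℤ) : ℤ[T;T⁻¹]) * (T j * T j)) := by
    rw [← RingHom.map_det, hdet, zsmul_eq_mul]
  have h1AB : (1 - A * B).det = φ x * φ (quantumInt (2 * m + 1)) := by
    rw [map_mul burau, Units.val_mul] at hx
    have := congrArg φ hx
    rw [map_mul, RingHom.map_det, map_sub, map_one, map_mul] at this
    exact this.symm
  rw [← hN, det_mul, det_mul, det_transpose, h1AB, det_nonsing_inv, Ring.inverse_eq_inv', hAdet,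
    hJdet] at hκ
  have hq0 : φ (quantumInt (2 * m + 1)) ≠ 0 := hJdet ▸ hJ0
  have hT : φ (T j) * φ (T (-j)) = 1 := by rw [← map_mul, ← T_add]; simp
  have h3 : (κ * φ (T (-j))) ^ 2 = φ (((ε : ℤ) : ℤ[T;T⁻¹]) * x) := by
    have h4 : κ * κ = φ x * φ ((ε : ℤ) : ℤ[T;T⁻¹]) * (φ (T j) * φ (T j)) := by
      rw [map_mul, map_mul] at hκ
      rw [← hκ]
      linear_combination (φ x * φ ((ε : ℤ) : ℤ[T;T⁻¹]) * (φ (T j) * φ (T j))) *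
        mul_inv_cancel₀ hq0
    rw [map_mul]
    linear_combination (φ (T (-j))) ^ 2 * h4 +
      φ x * φ ((ε : ℤ) : ℤ[T;T⁻¹]) * (φ (T j) * φ (T (-j)) + 1) * hT
  -- The square root lives in the fraction field; its square is a Laurent polynomial, so integral
  -- closedness brings it back.
  obtain ⟨G, hG⟩ := IsIntegrallyClosed.exists_algebraMap_eq_of_isIntegral_pow (R := ℤ[T;T⁻¹])
    (K := K) two_pos (by rw [h3]; exact isIntegral_algebraMap)
  refine ⟨G, ε, hφ ?_⟩
  rw [map_pow, ← h3, ← hG]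

/-- Inverting s replaces the braid by its mirror, which has the same characteristic polynomial; so
det(1 − ψ), and with it Δ, is symmetric. -/
theorem exists_symmEval_comp_mul_quantumInt {m : ℕ} (W : BraidGroup (2 * m + 1)) (l : ℕ)
    {c : ℤ[T;T⁻¹]} (hc : substSq c * quantumInt (2 * m + 1) =
      (1 - (burau ((W * mirror W) ^ l)).val).det) :
    ∃ H : ℤ[X], substSq c = symmEval (H.comp (X ^ 2 - 2)) := by
  apply exists_symmEval_comp_eq
  apply mul_right_cancel₀ (quantumInt_ne_zero (2 * m))
  have h1 := congrArg invert hc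
  rw [map_mul, invert_quantumInt, AlgEquiv.map_det, map_sub, map_one] at h1
  have h2 : (invert : ℤ[T;T⁻¹] ≃ₐ[ℤ] ℤ[T;T⁻¹]).mapMatrix (burau ((W * mirror W) ^ l)).val =
      (burau (mirror ((W * mirror W) ^ l))).val := (burau_mirror _).symm
  rw [h1, h2, hc, det_sub_eq_charpoly, det_sub_eq_charpoly, charpoly_burau_mirror]

/-- The divisibility by [n] comes from the Alexander matrix of some closure, which need not be a
knot. This serves the intermediate powers in the induction. -/
theorem exists_mul_quantumInt_eq {m : ℕ} (W : BraidGroup (2 * m + 1)) (l : ℕ) :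
    ∃ H : ℤ[X], symmEval (H.comp (X ^ 2 - 2)) * quantumInt (2 * m + 1) =
      (1 - (burau ((W * mirror W) ^ l)).val).det := by
  obtain ⟨v, hv⟩ := exists_toBraid ((W * mirror W) ^ l)
  obtain ⟨c, -, hc, -⟩ := v.exists_isAlexanderPolynomial
  rw [hv] at hc
  obtain ⟨H, hH⟩ := exists_symmEval_comp_mul_quantumInt W l hc
  exact ⟨H, by rw [← hH, hc]⟩

theorem det_one_sub_sq {k : ℕ} (M : Matrix (Fin k) (Fin k) ℤ[T;T⁻¹]) :
    (1 - M ^ 2).det = (1 - M).det * (1 + M).det := by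
  rw [← det_mul]
  congr 1
  noncomm_ring

/-- The two determinants are (−1)^m q(−2) and q(2), and 2 − (−2) = 4 divides the difference of the
values of q. -/
theorem det_one_add_eq {m : ℕ} (W : BraidGroup (2 * m + 1)) (l : ℕ) :
    ∃ r, (1 + (burau ((W * mirror W) ^ l)).val).det =
      (-1) ^ m * (1 - (burau ((W * mirror W) ^ l)).val).det + 4 * r := by
  obtain ⟨q, hq⟩ := charpoly_burau_palindromic W l
  obtain ⟨r, hr⟩ := sub_dvd_eval_sub (-2) 2 q
  have h1 := hq ℤ[T;T⁻¹] 1 1 (by ring)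
  have h2 := hq ℤ[T;T⁻¹] (-1) (-1) (by ring)
  rw [one_pow, one_mul, coe_aeval_eq_eval, coe_aeval_eq_eval, one_add_one_eq_two] at h1
  rw [coe_aeval_eq_eval, coe_aeval_eq_eval, show (-1 + -1 : ℤ[T;T⁻¹]) = -2 by norm_num] at h2
  refine ⟨-(-1) ^ m * r, ?_⟩
  rw [det_add_eq_charpoly (m := m) (by omega), det_sub_eq_charpoly, h1, h2]
  linear_combination (-1) ^ m * hr

/-- A polynomial of the form `± F(X) F(-X)` modulo `4`. -/
def SplitsModFour (p : ℤ[X]) : Prop :=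
  ∃ (F r : ℤ[X]) (ε : ℤˣ), p = ((ε : ℤ) : ℤ[X]) * (F * F.comp (-X)) + 4 * r

/-- Induction through 1 − M² = (1 − M)(1 + M). Nonvanishing at s = 1 passes to both factors; it
excludes antisymmetric square roots and permits cancellation. -/
theorem splitsModFour_of_pow_two {m : ℕ} (W : BraidGroup (2 * m + 1)) (a : ℕ) {H : ℤ[X]}
    (hH : symmEval (H.comp (X ^ 2 - 2)) * quantumInt (2 * m + 1) =
      (1 - (burau ((W * mirror W) ^ 2 ^ a)).val).det)
    (h0 : evalOne (symmEval (H.comp (X ^ 2 - 2))) ≠ 0) :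
    SplitsModFour (H.comp (X ^ 2 - 2)) := by
  have hq0 := quantumInt_ne_zero (2 * m)
  have hstep : ∀ (l : ℕ) (H H' : ℤ[X]),
      symmEval (H.comp (X ^ 2 - 2)) * quantumInt (2 * m + 1) =
        (1 - (burau ((W * mirror W) ^ (l * 2))).val).det →
      symmEval (H'.comp (X ^ 2 - 2)) * quantumInt (2 * m + 1) =
        (1 - (burau ((W * mirror W) ^ l)).val).det →
      symmEval (H.comp (X ^ 2 - 2)) =
        symmEval (H'.comp (X ^ 2 - 2)) * (1 + (burau ((W * mirror W) ^ l)).val).det := by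
    intro l H H' hH hH'
    apply mul_right_cancel₀ hq0
    rw [hH, pow_mul, map_pow burau _ 2, Units.val_pow_eq_pow_val, det_one_sub_sq, ← hH']
    ring
  induction a generalizing H with
  | zero =>
    rw [pow_zero, pow_one] at hH
    obtain ⟨G, ε, hG⟩ := exists_sq_eq W hH
    have hG' : G ^ 2 = symmEval (((ε : ℤ) : ℤ[X]) * H.comp (X ^ 2 - 2)) := by
      rw [hG, map_mul, map_intCast]
    have hε : ((ε : ℤ) : ℤ[X]) * ((ε : ℤ) : ℤ[X]) = 1 := by
      rw [← Int.cast_mul, ← Units.val_mul, Int.units_mul_self]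
      simp
    obtain ⟨F, δ, hF⟩ := exists_symmEval_mul_of_sq hG'
      (by rw [mul_comp, intCast_comp, comp_sq_comp_neg])
      (by
        intro h
        have := congrArg evalOne hG
        rw [map_pow, h, map_mul, map_intCast] at this
        rcases Int.units_eq_one_or ε with rfl | rfl
        · exact h0 (by simpa using this.symm)
        · exact h0 (by simpa using this.symm))
    refine ⟨F, 0, ε * δ, ?_⟩
    push_cast
    linear_combination ((ε : ℤ) : ℤ[X]) * hF - H.comp (X ^ 2 - 2) * hε
  | succ a ih =>
    obtain ⟨H', hH'⟩ := exists_mul_quantumInt_eq W (2 ^ a)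
    rw [pow_succ 2 a] at hH
    have h1 := hstep _ H H' hH hH'
    have h0' : evalOne (symmEval (H'.comp (X ^ 2 - 2))) ≠ 0 := by
      intro h
      rw [h1, map_mul, h, zero_mul] at h0
      exact h0 rfl
    have h0d : evalOne ((1 + (burau ((W * mirror W) ^ 2 ^ a)).val).det) ≠ 0 := by
      intro h
      rw [h1, map_mul, h, mul_zero] at h0
      exact h0 rfl
    have hp0 : symmEval (H'.comp (X ^ 2 - 2)) ≠ 0 := by
      intro h
      rw [h, map_zero] at h0'
      exact h0' rfl
    rcases a with _ | b
    -- From WW* to its square: modulo 4 the result is p² P(y)P(−y), and p is even in y, so F = Pp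
    -- works; the signs (−1)^m cancel.
    · obtain ⟨r, hr⟩ := det_one_add_eq W (2 ^ 0)
      obtain ⟨P, hP⟩ := exists_quantumInt_eq m
      set p := H'.comp (X ^ 2 - 2) with hp
      have hpneg : p.comp (-X) = p := comp_sq_comp_neg H'
      have h2 : ((-1) ^ m * (-1) ^ m : ℤ[T;T⁻¹]) = 1 := by rw [← mul_pow]; simp
      have h3 : symmEval (H.comp (X ^ 2 - 2)) =
          symmEval ((P * p) * (P * p).comp (-X)) + 4 * (r * symmEval p) := by
        rw [h1, hr, ← hH', hP, mul_comp, hpneg]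
        simp only [map_mul]
        linear_combination (symmEval P * symmEval (P.comp (-X)) * symmEval p ^ 2) * h2
      have h4 : invert (r * symmEval p) = r * symmEval p := by
        have h5 := congrArg invert h3
        rw [map_add, invert_symmEval, invert_symmEval, map_mul invert 4, map_ofNat, h3] at h5
        have h6 : (4 : ℤ[T;T⁻¹]) ≠ 0 := ofNat_ne_zero_of_int 4
        exact (mul_left_cancel₀ h6 (add_left_cancel h5)).symm
      obtain ⟨r', hr'⟩ := exists_symmEval_eq h4
      refine ⟨P * p, r', 1, symmEval_injective ?_⟩
      rw [h3, ← hr', map_add, map_mul symmEval 4, map_ofNat]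
      simp
    -- From the second squaring on, M is the square of a matrix with reciprocal characteristic
    -- polynomial, so the new factor is a square and splits exactly.
    · have h2 : ∃ x, (1 + (burau ((W * mirror W) ^ 2 ^ (b + 1))).val).det = x ^ 2 := by
        obtain ⟨q, hq⟩ := charpoly_burau_palindromic W (2 ^ b)
        refine ⟨q.eval 0, ?_⟩
        rw [← det_one_add_sq_of_palindromic _ hq, pow_succ 2 b, pow_mul, map_pow burau _ 2,
          Units.val_pow_eq_pow_val]
      obtain ⟨x, hx⟩ := h2
      have h3 : invert (x ^ 2) = x ^ 2 := by
        have h4 := congrArg invert h1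
        rw [map_mul, invert_symmEval, invert_symmEval, h1, hx] at h4
        exact (mul_left_cancel₀ hp0 h4).symm
      obtain ⟨d, hd⟩ := exists_symmEval_eq h3
      have h4 : H.comp (X ^ 2 - 2) = H'.comp (X ^ 2 - 2) * d := by
        apply symmEval_injective
        rw [map_mul, hd, h1, hx]
      have h5 : d.comp (-X) = d := by
        have h6 := congrArg (fun p => p.comp (-X)) h4
        simp only [mul_comp, comp_sq_comp_neg] at h6
        rw [h4] at h6
        refine (mul_left_cancel₀ ?_ h6).symm
        intro h
        exact hp0 (by rw [h, map_zero])
      obtain ⟨F, δ, hF⟩ := exists_symmEval_mul_of_sq hd.symm h5 (by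
        intro h
        rw [hx, map_pow, h] at h0d
        exact h0d (by norm_num))
      obtain ⟨F', r, ε, hF'⟩ := ih hH' h0'
      refine ⟨F' * F, r * d, ε * δ, ?_⟩
      rw [h4, hF', mul_comp]
      push_cast
      linear_combination ((ε : ℤ) : ℤ[X]) * (F' * F'.comp (-X)) * hF

/-- For an odd exponent, (ww*)^(2j+1) = WW* with W = (ww*)^j w, because W* = (w*w)^j w*. -/
theorem exists_pow_eq_pow_two {n k : ℕ} (hk : 1 ≤ k) (w : BraidGroup n) :
    ∃ (W : BraidGroup n) (a : ℕ), (w * mirror w) ^ k = (W * mirror W) ^ 2 ^ a := by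
  obtain ⟨a, b, ⟨j, rfl⟩, rfl⟩ := Nat.exists_eq_two_pow_mul_odd (by omega : k ≠ 0)
  refine ⟨(w * mirror w) ^ j * w, a, ?_⟩
  rw [mul_comm, pow_mul]
  congr 1
  rw [map_mul mirror, map_pow mirror, map_mul mirror, mirror_mirror, mul_pow_conj w (mirror w) j, two_mul,
    pow_succ, pow_add]
  group

end BraidGroup

theorem mainTheorem2 (n k : ℕ) (hn : Odd n) (hk : 1 ≤ k) (w : BraidGroup n) (v : BraidWord n)
    (hv : v.toBraid = (w * BraidGroup.mirror w) ^ k) (hK : v.closure.IsKnot) :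
    (∃! C : ℤ[X], v.closure.IsConwayPolynomial C) ∧
      ∀ C : ℤ[X], v.closure.IsConwayPolynomial C →
        ∃ f : (ZMod 4)[X], C.map (Int.castRingHom (ZMod 4)) = f * f.comp (-X) := by
  obtain ⟨m, rfl⟩ := hn
  obtain ⟨W, a, hW⟩ := BraidGroup.exists_pow_eq_pow_two hk w
  obtain ⟨c, hc, hdet, hu⟩ := v.exists_isAlexanderPolynomial
  have hu := hu hK
  rw [hv, hW] at hdet
  obtain ⟨H, hH⟩ := BraidGroup.exists_symmEval_comp_mul_quantumInt W _ hdet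
  rw [hH] at hdet
  obtain ⟨F, r, ε, hF⟩ := BraidGroup.splitsModFour_of_pow_two W a hdet
    (by rw [← hH, evalOne_substSq]; exact hu.ne_zero)
  exact v.closure.existsUnique_isConwayPolynomial_and_splits hc hu hH hF
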